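/- Let $(X,\mathcal B,\mu)$ be a standard (Lebesgue) non-atomic probability space and let $S$ be a weakly mixing automorphism of it, i.e. an invertible bimeasurable $\mu$-preserving map for which there is a sequence $j_k\to\infty$ with $\mu(A\cap S^{j_k}B)\to\mu(A)\mu(B)$ for all $A,B\in\mathcal B$. Let $\mathrm{Aut}(\mu\otimes\mu)$ be the set of automorphisms of $(X\times X,\mu\otimes\mu)$ (identified when equal almost everywhere), with the Halmos metric $$\rho(R,R')=\sum_i 2^{-i}\bigl((\mu\otimes\mu)(RA_i\,\Delta\,R'A_i)+(\mu\otimes\mu)(R^{-1}A_i\,\Delta\,R'^{-1}A_i)\bigr),$$ where $\{A_i\}$ is any sequence of measurable sets dense in the measure algebra of $\mu\otimes\mu$. Let $\mathrm{Ext}(S)\subset\mathrm{Aut}(\mu\otimes\mu)$ be the subspace of extensions of $S$, i.e. of skew products $R(x,y)=(Sx,R_xy)$, where $\{R_x\}$ is a measurable family of automorphisms of $(X,\mu)$. Then a generic extension of $S$ has no nontrivial factor independent of the base $S$-factor: there is a dense $G_\delta$ subset $G$ of $\mathrm{Ext}(S)$ such that for every $R\in G$ and every sub-$\sigma$-algebra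 $\mathcal F$ of $\mathcal B\otimes\mathcal B$ with $R^{-1}\mathcal F=\mathcal F$, if $\mathcal F$ is independent, with respect to $\mu\otimes\mu$, of the $\sigma$-algebra $\{A\times X: A\in\mathcal B\}$, then $(\mu\otimes\mu)(E)\in\{0,1\}$ for every $E\in\mathcal F$. -/

import Mathlib

open MeasureTheory Filter Topology ProbabilityTheory
open scoped symmDiff

namespace GenericExt

/-- Automorphisms of the measure space `(Ω, ν)`: invertible bimeasurable maps preserving `ν`.
Automorphisms that agree almost everywhere are at distance zero in the Halmos (pseudo)metric below,
so they are identified by the topology. -/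
def Aut {Ω : Type*} [MeasurableSpace Ω] (ν : Measure Ω) : Type _ :=
  {T : Ω ≃ᵐ Ω // MeasurePreserving T ν ν}

instance {Ω : Type*} [MeasurableSpace Ω] (ν : Measure Ω) : CoeFun (Aut ν) (fun _ => Ω → Ω) :=
  ⟨fun T => T.1⟩

/-- `T` is weakly mixing: it has a mixing sequence, i.e. there are `j k → ∞` such that
`ν (A ∩ T ^ (j k) B) → ν A * ν B` for all measurable sets `A`, `B`. -/
def WeaklyMixing {Ω : Type*} [MeasurableSpace Ω] {ν : Measure Ω} (T : Aut ν) : Prop :=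
  ∃ j : ℕ → ℕ, Tendsto j atTop atTop ∧
    ∀ A B : Set Ω, MeasurableSet A → MeasurableSet B →
      Tendsto (fun k => ν (A ∩ T^[j k] '' B)) atTop (𝓝 (ν A * ν B))

/-- The `i`-th summand `ν (S A Δ T A) + ν (S⁻¹ A Δ T⁻¹ A)` (for `A = A i`) of the Halmos metric. -/
noncomputable def halmosTerm {Ω : Type*} [MeasurableSpace Ω] {ν : Measure Ω} (A : Set Ω)
    (S T : Aut ν) : ℝ :=
  ν.real ((S '' A) ∆ (T '' A)) + ν.real ((S ⁻¹' A) ∆ (T ⁻¹' A))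

/-- The Halmos distance `ρ(S, T) = ∑ᵢ 2⁻ⁱ (ν (S Aᵢ Δ T Aᵢ) + ν (S⁻¹ Aᵢ Δ T⁻¹ Aᵢ))` given by a
family `A` of sets. -/
noncomputable def halmosDist {Ω : Type*} [MeasurableSpace Ω] {ν : Measure Ω} (A : ℕ → Set Ω)
    (S T : Aut ν) : ℝ :=
  ∑' i, (1 / 2 : ℝ) ^ i * halmosTerm (A i) S T

theorem halmosTerm_nonneg {Ω : Type*} [MeasurableSpace Ω] {ν : Measure Ω} (A : Set Ω)
    (S T : Aut ν) : 0 ≤ halmosTerm A S T :=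
  add_nonneg measureReal_nonneg measureReal_nonneg

theorem summable_halmos {Ω : Type*} [MeasurableSpace Ω] {ν : Measure Ω} [IsFiniteMeasure ν]
    (A : ℕ → Set Ω) (S T : Aut ν) :
    Summable (fun i => (1 / 2 : ℝ) ^ i * halmosTerm (A i) S T) := by
  refine Summable.of_nonneg_of_le
    (fun i => mul_nonneg (by positivity) (halmosTerm_nonneg _ _ _))
    (fun i => mul_le_mul_of_nonneg_left
      (add_le_add (measureReal_mono (Set.subset_univ _)) (measureReal_mono (Set.subset_univ _)))
      (by positivity)) (summable_geometric_two.mul_right (ν.real Set.univ + ν.real Set.univ))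

theorem measureReal_symmDiff_triangle {Ω : Type*} [MeasurableSpace Ω] (ν : Measure Ω)
    [IsFiniteMeasure ν] (A B C : Set Ω) : ν.real (A ∆ C) ≤ ν.real (A ∆ B) + ν.real (B ∆ C) :=
  (measureReal_mono (symmDiff_triangle A B C)).trans (measureReal_union_le _ _)

/-- The Halmos pseudometric on the automorphisms of a finite measure space. -/
@[reducible] noncomputable def halmosMetric {Ω : Type*} [MeasurableSpace Ω] (ν : Measure Ω)
    [IsFiniteMeasure ν] (A : ℕ → Set Ω) : PseudoMetricSpace (Aut ν) where
  dist := halmosDist A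
  dist_self T := by simp [halmosDist, halmosTerm]
  dist_comm S T := by simp [halmosDist, halmosTerm, symmDiff_comm]
  dist_triangle S T U := by
    unfold halmosDist
    rw [← (summable_halmos A S T).tsum_add (summable_halmos A T U)]
    refine (summable_halmos A S U).tsum_le_tsum (fun i => ?_)
      ((summable_halmos A S T).add (summable_halmos A T U))
    rw [← mul_add]
    refine mul_le_mul_of_nonneg_left ?_ (by positivity)
    have h1 := measureReal_symmDiff_triangle ν (S '' A i) (T '' A i) (U '' A i)
    have h2 := measureReal_symmDiff_triangle ν (S ⁻¹' A i) (T ⁻¹' A i) (U ⁻¹' A i)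
    unfold halmosTerm
    linarith

/-- The extensions of `S` (skew products over `S`): the automorphisms `R` of `(X × X, μ ⊗ μ)` of the
form `R (x, y) = (S x, R_x y)`, where `R_x` is a measurable family of automorphisms of `(X, μ)`. -/
def Ext {X : Type*} [MeasurableSpace X] {μ : Measure X} (S : Aut μ) : Set (Aut (μ.prod μ)) :=
  {R | ∃ F : X → Aut μ, Measurable (fun p : X × X => F p.1 p.2) ∧
    ∀ᵐ p ∂(μ.prod μ), R p = (S p.1, F p.1 p.2)}

/-- A property `P` of automorphisms of `X × X` is generic for extensions of `S`: some dense
`G_δ` subset of the space `Ext S`, with the topology of the Halmos metric, consists of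
extensions with property `P`. -/
def IsGenericForExt {X : Type*} [MeasurableSpace X] {μ : Measure X} [IsFiniteMeasure μ]
    (A : ℕ → Set (X × X)) (S : Aut μ) (P : Aut (μ.prod μ) → Prop) : Prop :=
  letI : PseudoMetricSpace (Aut (μ.prod μ)) := halmosMetric (μ.prod μ) A
  ∃ G : Set (Ext S), IsGδ G ∧ Dense G ∧ ∀ R ∈ G, P R.1

/-- A factor of `T`, given by a `T`-invariant sub-σ-algebra `m` (that is, `T⁻¹ m = m`). -/
def IsFactor {Ω : Type*} {mΩ : MeasurableSpace Ω} {ν : Measure Ω} (T : Aut ν)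
    (m : MeasurableSpace Ω) : Prop :=
  m ≤ mΩ ∧ m.comap T = m

/-- The factor given by `m` is trivial: `m` contains only sets of measure `0` or `1`. -/
def IsTrivialFactor {Ω : Type*} {mΩ : MeasurableSpace Ω} (ν : Measure Ω)
    (m : MeasurableSpace Ω) : Prop :=
  ∀ E : Set Ω, MeasurableSet[m] E → ν E = 0 ∨ ν E = 1

/-- The σ-algebra of the base factor of an extension: all sets `A × X` with `A` measurable. -/
@[reducible] def baseFactor (X : Type*) [mX : MeasurableSpace X] : MeasurableSpace (X × X) :=
  mX.comap Prod.fst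

/-- `R` has a nontrivial factor independent of the base factor. -/
def HasNontrivialIndepFactor {X : Type*} [MeasurableSpace X] {μ : Measure X}
    (R : Aut (μ.prod μ)) : Prop :=
  ∃ m : MeasurableSpace (X × X), IsFactor R m ∧ ¬ IsTrivialFactor (μ.prod μ) m ∧
    Indep m (baseFactor X) (μ.prod μ)

end GenericExt

open scoped ENNReal

/-! Suppose `E` lies in a factor of `R` independent of the base. Then so does every `E ∆ R^[t] ⁻¹'
E`, so over any base set `D` it has measure `μ D` times its total measure. If `R` is nearly mixing
on `E` at the times `t i`, with `a` the measure of `E`, then `E` is displaced over `D i` by about `2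
a (1 - a) μ (D i)`. If at the same time the piecewise power of `R` that uses time `t i` over `D i`
nearly fixes `E`, and the `D i` fill half of the base, then `a (1 - a) = 0`. `recurrentMixing`
encodes this pair of behaviours on the dense sets `A k`, and `false_of_mem_recurrentMixing` is the
contradiction.

These conditions are open in the Halmos topology. For density, start from any family `F` and a small
set `E` of positive measure. Changing the cocycle only at points entering `E` turns the skew product
into a conjugate of `S × id` by fibre maps `G`. Over each stretch of orbit between visits to `E`,
`G` may be composed with a constant power of `S`; since `S` is weakly mixing, these powers can be
chosen so that the sections of the conjugated sets are nearly pairwise independent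
(`exists_lintegral_sectionCorr_le`). Then `S × id` is nearly mixing on these sets along the mixing
sequence of `S`. It also has piecewise powers that nearly fix them, because a piecewise power of `S`
can respect any countable partition of the base (`exists_isPiecewisePower`). The Baire theorem
finishes the proof. -/

namespace GenericExt

/-! ### Automorphisms and skew products given by everywhere defined families. -/

section

section Aut

variable {Ω : Type*} [MeasurableSpace Ω] {ν : Measure Ω}

/-- The composition `S ∘ T` of automorphisms. -/
def Aut.comp (S T : Aut ν) : Aut ν := ⟨T.1.trans S.1, S.2.comp T.2⟩

/-- The inverse automorphism. -/
def Aut.symm (S : Aut ν) : Aut ν := ⟨S.1.symm, S.2.symm S.1⟩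

/-- The identity automorphism. -/
def Aut.refl (ν : Measure Ω) : Aut ν := ⟨MeasurableEquiv.refl Ω, MeasurePreserving.id ν⟩

/-- The iterates of an automorphism. -/
def Aut.iter (S : Aut ν) : ℕ → Aut ν
  | 0 => Aut.refl ν
  | n + 1 => (S.iter n).comp S

@[simp] theorem Aut.comp_apply (S T : Aut ν) (x : Ω) : S.comp T x = S (T x) := rfl

@[simp] theorem Aut.refl_apply (x : Ω) : Aut.refl ν x = x := rfl

@[simp] theorem Aut.symm_apply_apply (S : Aut ν) (x : Ω) : S.symm (S x) = x :=
  S.1.symm_apply_apply x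

@[simp] theorem Aut.apply_symm_apply (S : Aut ν) (x : Ω) : S (S.symm x) = x :=
  S.1.apply_symm_apply x

theorem Aut.iter_coe (S : Aut ν) (n : ℕ) : (S.iter n : Ω → Ω) = S^[n] := by
  induction n with
  | zero => rfl
  | succ n ih =>
    funext x
    simp [Aut.iter, ih, Function.iterate_succ_apply]

theorem Aut.ext {S T : Aut ν} (h : ∀ x, S x = T x) : S = T :=
  Subtype.ext (MeasurableEquiv.ext (funext h))

theorem Aut.measurable (S : Aut ν) : Measurable S := S.1.measurable

theorem Aut.injective (S : Aut ν) : Function.Injective S := S.1.injective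

theorem Aut.measure_preimage (S : Aut ν) (B : Set Ω) : ν (S ⁻¹' B) = ν B :=
  MeasurePreserving.measure_preimage_equiv (f := S.1) S.2 B

theorem Aut.measureReal_preimage (S : Aut ν) (B : Set Ω) : ν.real (S ⁻¹' B) = ν.real B := by
  rw [measureReal_def, S.measure_preimage, measureReal_def]

theorem Aut.image_eq (S : Aut ν) (B : Set Ω) : S '' B = S.symm ⁻¹' B :=
  S.1.image_eq_preimage_symm B

theorem Aut.measure_image (S : Aut ν) (B : Set Ω) : ν (S '' B) = ν B := by
  rw [S.image_eq, S.symm.measure_preimage]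

theorem Aut.measure_iterate_preimage (S : Aut ν) (n : ℕ) (B : Set Ω) :
    ν (S^[n] ⁻¹' B) = ν B := by
  rw [← S.iter_coe, Aut.measure_preimage]

theorem Aut.measureReal_iterate_preimage (S : Aut ν) (n : ℕ) (B : Set Ω) :
    ν.real (S^[n] ⁻¹' B) = ν.real B := by
  rw [measureReal_def, S.measure_iterate_preimage, measureReal_def]

theorem Aut.measure_iterate_image (S : Aut ν) (n : ℕ) (B : Set Ω) :
    ν (S^[n] '' B) = ν B := by
  rw [← S.iter_coe, Aut.measure_image]

theorem Aut.measurableSet_image (S : Aut ν) {B : Set Ω} (hB : MeasurableSet B) :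
    MeasurableSet (S '' B) := by
  rw [S.image_eq]; exact S.symm.measurable hB

theorem Aut.measurableSet_iterate_image (S : Aut ν) (n : ℕ) {B : Set Ω} (hB : MeasurableSet B) :
    MeasurableSet (S^[n] '' B) := by
  rw [← S.iter_coe]; exact Aut.measurableSet_image _ hB

end Aut

/-- The least `n` with `x ∈ E n` (and `0` if there is none) depends measurably on `x`. -/
theorem measurable_sInf_mem {Ω : Type*} [MeasurableSpace Ω] {E : ℕ → Set Ω}
    (hE : ∀ n, MeasurableSet (E n)) : Measurable (fun x => sInf {n | x ∈ E n}) := by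
  classical
  have h : (fun x => sInf {n | x ∈ E n}) = fun x =>
      if hx : ∃ n, x ∈ E n then Nat.find hx else 0 := by
    funext x
    by_cases hx : ∃ n, x ∈ E n
    · rw [dif_pos hx]
      exact Nat.sInf_def hx
    · rw [dif_neg hx, Nat.sInf_eq_zero]
      right
      ext n
      simpa using fun hn => hx ⟨n, hn⟩
  rw [h]
  refine measurable_to_countable' fun k => ?_
  have hk : (fun x => if hx : ∃ n, x ∈ E n then Nat.find hx else 0) ⁻¹' {k} =
      (E k \ ⋃ i ∈ Set.Iio k, E i) ∪ (if k = 0 then (⋃ n, E n)ᶜ else ∅) := by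
    ext x
    by_cases hx : ∃ n, x ∈ E n
    · have : x ∈ ⋃ n, E n := by simpa using hx
      simp only [Set.mem_preimage, Set.mem_singleton_iff, dif_pos hx, Nat.find_eq_iff]
      split_ifs <;> simp [hx]
    · have h' : ∀ n, x ∉ E n := fun n hn => hx ⟨n, hn⟩
      by_cases h0 : k = 0
      · simp [h', h0]
      · simp [h', h0, Ne.symm h0]
  rw [hk]
  refine ((hE k).diff (MeasurableSet.biUnion (Set.to_countable _) fun i _ => hE i)).union ?_
  split_ifs
  · exact (MeasurableSet.iUnion hE).compl
  · exact MeasurableSet.empty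

variable {X : Type*} [MeasurableSpace X] {μ : Measure X}

/-- The measurable families of automorphisms of `(X, μ)`, indexed by `X`. -/
def Family (μ : Measure X) : Type _ :=
  {F : X → Aut μ // Measurable (fun p : X × X => F p.1 p.2)}

variable [StandardBorelSpace X] [IsProbabilityMeasure μ]

/-- The skew product `(x, y) ↦ (S x, F x y)`. -/
noncomputable def skew (S : Aut μ) (F : Family μ) : Aut (μ.prod μ) :=
  ⟨{ toEquiv := ⟨fun p => (S p.1, F.1 p.1 p.2),
        fun p => (S.symm p.1, (F.1 (S.symm p.1)).symm p.2),
        fun p => by simp, fun p => by simp⟩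
     measurable_toFun := (S.measurable.comp measurable_fst).prodMk F.2
     -- By the Lusin–Souslin theorem, an injective measurable map between standard Borel spaces
     -- sends measurable sets to measurable sets.
     measurable_invFun := by
      have hm : Measurable (fun p : X × X => (S p.1, F.1 p.1 p.2)) :=
        (S.measurable.comp measurable_fst).prodMk F.2
      have hi : Function.Injective (fun p : X × X => (S p.1, F.1 p.1 p.2)) := by
        rintro ⟨a, b⟩ ⟨c, d⟩ h
        obtain ⟨h1, h2⟩ := Prod.mk.inj h
        obtain rfl : a = c := S.injective h1
        obtain rfl : b = d := (F.1 a).injective h2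
        rfl
      intro B hB
      convert (hm.measurableEmbedding hi).measurableSet_image.2 hB using 1
      ext p
      simp only [Set.mem_preimage, Set.mem_image]
      constructor
      · intro h
        exact ⟨_, h, by simp⟩
      · rintro ⟨q, hq, rfl⟩
        simpa using hq },
    S.2.skew_product (g := fun x y => F.1 x y) F.2
      (Eventually.of_forall fun x => (F.1 x).2.map_eq)⟩

@[simp] theorem skew_apply (S : Aut μ) (F : Family μ) (p : X × X) :
    skew S F p = (S p.1, F.1 p.1 p.2) := rfl

theorem Family.measurable_symm (F : Family μ) :
    Measurable (fun p : X × X => (F.1 p.1).symm p.2) :=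
  measurable_snd.comp (skew (Aut.refl μ) F).symm.measurable

theorem skew_mem_Ext (S : Aut μ) (F : Family μ) : skew S F ∈ Ext S :=
  ⟨F.1, F.2, Eventually.of_forall fun _ => rfl⟩

end

section

/-! ### The complete space of measurable families. -/

section FamilySpace

variable {X : Type*} [MeasurableSpace X] {μ : Measure X}

/-- The distance between two families is the measure of the set where they differ. -/
noncomputable instance : PseudoEMetricSpace (Family μ) where
  edist F G := μ {x | F.1 x ≠ G.1 x}
  edist_self F := by simp
  edist_comm F G := by simp [ne_comm]
  edist_triangle F G H := by
    refine (measure_mono ?_).trans (measure_union_le _ _)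
    intro x hx
    by_contra! h
    simp only [Set.mem_union, Set.mem_ofPred_eq, not_or, not_not] at h
    exact hx (h.1.trans h.2)

theorem Family.edist_def (F G : Family μ) : edist F G = μ {x | F.1 x ≠ G.1 x} := rfl

/-- A Borel–Cantelli argument: if consecutive terms differ on sets of summable measure, almost every
point sees an eventually constant sequence. Completeness makes the Baire theorem available for
families. -/
instance : CompleteSpace (Family μ) := by
  refine EMetric.complete_of_convergent_controlled_sequences (fun n => (1 / 2 : ℝ≥0∞) ^ n)
    (fun n => ENNReal.pow_pos (by simp) n) fun u hu => ?_
  -- The set where two families differ need not be measurable, hence the measurable hull.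
  set Z : ℕ → Set X := fun n => toMeasurable μ {x | (u n).1 x ≠ (u (n + 1)).1 x} with hZ
  have hZm : ∀ n, MeasurableSet (Z n) := fun n => measurableSet_toMeasurable _ _
  have hZμ : ∀ n, μ (Z n) ≤ (1 / 2 : ℝ≥0∞) ^ n := fun n => by
    rw [hZ, measure_toMeasurable]
    exact (hu n n (n + 1) le_rfl n.le_succ).le
  -- On `E n` the sequence is constant from index `n` on. The limit uses the first such index; the
  -- default index `0` applies only on a null set.
  set E : ℕ → Set X := fun n => ⋂ k, (Z (n + k))ᶜ with hE
  have hEm : ∀ n, MeasurableSet (E n) := fun n => MeasurableSet.iInter fun k => (hZm _).compl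
  have hN := measurable_sInf_mem hEm
  have heq : ∀ m k x, x ∈ E m → (u (m + k)).1 x = (u m).1 x := by
    intro m k x hx
    induction k with
    | zero => rfl
    | succ k ih =>
      rw [← ih]
      have h1 : x ∉ Z (m + k) := Set.mem_iInter.1 hx k
      by_contra h
      exact h1 (subset_toMeasurable _ _ (Ne.symm h))
  have hF : Measurable (fun p : X × X => (u (sInf {n | p.1 ∈ E n})).1 p.1 p.2) := by
    have h1 : Measurable (fun q : ℕ × (X × X) => (u q.1).1 q.2.1 q.2.2) :=
      measurable_from_prod_countable_right fun n => (u n).2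
    exact h1.comp ((hN.comp measurable_fst).prodMk measurable_id)
  let F : Family μ := ⟨fun x => (u (sInf {n | x ∈ E n})).1 x, hF⟩
  refine ⟨F, ?_⟩
  rw [tendsto_iff_edist_tendsto_0]
  have hlim : Tendsto (fun n : ℕ => (1 / 2 : ℝ≥0∞) ^ n * 2) atTop (𝓝 0) := by
    have := ENNReal.Tendsto.mul_const (b := 2)
      (ENNReal.tendsto_pow_atTop_nhds_zero_of_lt_one (r := (1 / 2 : ℝ≥0∞)) (by simp))
      (Or.inr (by simp))
    simpa using this
  refine tendsto_of_tendsto_of_tendsto_of_le_of_le tendsto_const_nhds hlim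
    (fun n => zero_le) fun n => ?_
  have hsub : {x | (u n).1 x ≠ (u (sInf {n | x ∈ E n})).1 x} ⊆ ⋃ k, Z (n + k) := by
    intro x hx
    by_contra hxn
    have hxE : x ∈ E n := by simpa [hE] using hxn
    have hmem : x ∈ E (sInf {n | x ∈ E n}) := Nat.sInf_mem (s := {n | x ∈ E n}) ⟨n, hxE⟩
    have hle : sInf {n | x ∈ E n} ≤ n := Nat.sInf_le hxE
    obtain ⟨k, hk⟩ := Nat.exists_eq_add_of_le hle
    have := heq _ k x hmem
    rw [← hk] at this
    exact hx this
  calc edist (u n) _ ≤ μ (⋃ k, Z (n + k)) := measure_mono hsub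
    _ ≤ ∑' k, μ (Z (n + k)) := measure_iUnion_le _
    _ ≤ ∑' k, (1 / 2 : ℝ≥0∞) ^ n * (1 / 2) ^ k :=
      ENNReal.tsum_le_tsum fun k => by rw [← pow_add]; exact hZμ _
    _ = (1 / 2 : ℝ≥0∞) ^ n * 2 := by
      rw [ENNReal.tsum_mul_left, one_div, ENNReal.tsum_geometric, ENNReal.one_sub_inv_two,
        inv_inv]

end FamilySpace

/-! ### Continuity in the Halmos metric. -/

section Halmos

variable {Ω : Type*} [MeasurableSpace Ω] {ν : Measure Ω} [IsFiniteMeasure ν]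

/-- Each preimage term costs `ν.real N` and each image term twice that; the weights `2⁻ⁱ` sum to
`2`, whence `6`. -/
theorem halmosDist_le {A : ℕ → Set Ω} {S T : Aut ν} {N : Set Ω} (h : ∀ p ∉ N, S p = T p) :
    halmosDist A S T ≤ 6 * ν.real N := by
  have h1 : ∀ i, halmosTerm (A i) S T ≤ 3 * ν.real N := by
    intro i
    have h2 : ν.real ((S '' A i) ∆ (T '' A i)) ≤ ν.real N + ν.real N := by
      have hS : ν.real (S '' N) = ν.real N := by simp [measureReal_def, S.measure_image]
      have hT : ν.real (T '' N) = ν.real N := by simp [measureReal_def, T.measure_image]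
      rw [← hS]
      nth_rewrite 2 [hS]
      rw [← hT]
      refine (measureReal_mono ?_).trans (measureReal_union_le _ _)
      rintro _ (⟨⟨p, hp, rfl⟩, hq⟩ | ⟨⟨p, hp, rfl⟩, hq⟩)
      · left
        refine ⟨p, ?_, rfl⟩
        by_contra hN
        exact hq ⟨p, hp, (h p hN).symm⟩
      · right
        refine ⟨p, ?_, rfl⟩
        by_contra hN
        exact hq ⟨p, hp, h p hN⟩
    have h3 : ν.real ((S ⁻¹' A i) ∆ (T ⁻¹' A i)) ≤ ν.real N := by
      refine measureReal_mono ?_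
      intro p hp
      by_contra hN
      simp [Set.mem_symmDiff, h p hN] at hp
    unfold halmosTerm
    linarith
  calc halmosDist A S T ≤ ∑' i : ℕ, (1 / 2 : ℝ) ^ i * (3 * ν.real N) :=
        (summable_halmos A S T).tsum_le_tsum
          (fun i => mul_le_mul_of_nonneg_left (h1 i) (by positivity))
          (summable_geometric_two.mul_right _)
    _ = 6 * ν.real N := by rw [tsum_mul_right, tsum_geometric_two]; ring

theorem halmosTerm_le_halmosDist (A : ℕ → Set Ω) (S T : Aut ν) (i : ℕ) :
    halmosTerm (A i) S T ≤ 2 ^ i * halmosDist A S T := by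
  have h := (summable_halmos A S T).le_tsum i
    fun j _ => mul_nonneg (by positivity) (halmosTerm_nonneg _ _ _)
  calc halmosTerm (A i) S T = 2 ^ i * ((1 / 2) ^ i * halmosTerm (A i) S T) := by
        rw [← mul_assoc, ← mul_pow]; norm_num
    _ ≤ _ := mul_le_mul_of_nonneg_left h (by positivity)

theorem exists_approx {A : ℕ → Set Ω} (hA : ν.MeasureDense (Set.range A)) {B : Set Ω}
    (hB : MeasurableSet B) {ε : ℝ} (hε : 0 < ε) : ∃ i, ν.real (B ∆ A i) < ε := by
  obtain ⟨_, ⟨i, rfl⟩, hi⟩ := hA.approx B hB (measure_ne_top _ _) ε hε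
  refine ⟨i, ?_⟩
  rw [measureReal_def]
  exact (ENNReal.lt_ofReal_iff_toReal_lt (measure_ne_top _ _)).1 hi

theorem exists_measure_symmDiff_iterate_lt {A : ℕ → Set Ω} (hA : ν.MeasureDense (Set.range A))
    (R : Aut ν) (t : ℕ) {B : Set Ω} (hB : MeasurableSet B) {ε : ℝ} (hε : 0 < ε) :
    ∃ δ > 0, ∀ R' : Aut ν, halmosDist A R' R < δ →
      ν.real ((R'^[t] ⁻¹' B) ∆ (R^[t] ⁻¹' B)) < ε := by
  induction t generalizing ε with
  | zero => exact ⟨1, one_pos, fun R' _ => by simpa using hε⟩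
  | succ t ih =>
    -- The metric controls only the sets `A i`, so `R^[t] ⁻¹' B` is replaced by some `A i`. The
    -- errors add up to `ε/4 + ε/8 + ε/4 + ε/8 < ε`.
    obtain ⟨δ, hδ, h⟩ := ih (ε := ε / 4) (by positivity)
    set C := R^[t] ⁻¹' B with hC
    have hCm : MeasurableSet C := (R.measurable.iterate t) hB
    obtain ⟨i, hi⟩ := exists_approx hA hCm (ε := ε / 8) (by positivity)
    refine ⟨min δ (ε / 4 / 2 ^ i), lt_min hδ (by positivity), fun R' hR' => ?_⟩
    have h1 := h R' (hR'.trans_le (min_le_left _ _))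
    have h2 : ν.real ((R' ⁻¹' A i) ∆ (R ⁻¹' A i)) < ε / 4 := by
      have h3 := halmosTerm_le_halmosDist A R' R i
      have h4 : 2 ^ i * halmosDist A R' R < ε / 4 := by
        have := hR'.trans_le (min_le_right _ _)
        rwa [lt_div_iff₀ (by positivity), mul_comm] at this
      have h5 : ν.real ((R' ⁻¹' A i) ∆ (R ⁻¹' A i)) ≤ halmosTerm (A i) R' R :=
        le_add_of_nonneg_left measureReal_nonneg
      linarith
    have e : ∀ T : Aut ν, T^[t + 1] ⁻¹' B = T ⁻¹' (T^[t] ⁻¹' B) := fun T => by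
      rw [← Set.preimage_comp, Function.iterate_succ]
    rw [e, e, ← hC]
    have h6 : ν.real ((R' ⁻¹' (R'^[t] ⁻¹' B)) ∆ (R' ⁻¹' C)) < ε / 4 := by
      rw [← Set.preimage_symmDiff, R'.measureReal_preimage]; exact h1
    have h7 : ν.real ((R' ⁻¹' C) ∆ (R' ⁻¹' A i)) < ε / 8 := by
      rw [← Set.preimage_symmDiff, R'.measureReal_preimage]; exact hi
    have h8 : ν.real ((R ⁻¹' A i) ∆ (R ⁻¹' C)) < ε / 8 := by
      rw [← Set.preimage_symmDiff, R.measureReal_preimage, symmDiff_comm]; exact hi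
    have t1 := measureReal_symmDiff_triangle ν (R' ⁻¹' (R'^[t] ⁻¹' B)) (R' ⁻¹' C) (R ⁻¹' C)
    have t2 := measureReal_symmDiff_triangle ν (R' ⁻¹' C) (R' ⁻¹' A i) (R ⁻¹' C)
    have t3 := measureReal_symmDiff_triangle ν (R' ⁻¹' A i) (R ⁻¹' A i) (R ⁻¹' C)
    linarith

theorem continuous_measureReal_inter_symmDiff {A : ℕ → Set Ω}
    (hA : ν.MeasureDense (Set.range A)) (t : ℕ) {B C D : Set Ω} (hB : MeasurableSet B)
    (hC : MeasurableSet C) (hD : MeasurableSet D) :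
    letI : PseudoMetricSpace (Aut ν) := halmosMetric ν A
    Continuous (fun R : Aut ν => ν.real (D ∩ (C ∆ (R^[t] ⁻¹' B)))) := by
  let _ : PseudoMetricSpace (Aut ν) := halmosMetric ν A
  refine Metric.continuous_iff.2 fun R ε hε => ?_
  obtain ⟨δ, hδ, h⟩ := exists_measure_symmDiff_iterate_lt hA R t hB hε
  refine ⟨δ, hδ, fun R' hR' => lt_of_le_of_lt ?_ (h R' hR')⟩
  have hm : ∀ T : Aut ν, MeasurableSet (D ∩ (C ∆ (T^[t] ⁻¹' B))) := fun T =>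
    hD.inter (hC.symmDiff ((T.measurable.iterate t) hB))
  rw [Real.dist_eq]
  refine (abs_measureReal_sub_le_measureReal_symmDiff (hm R').nullMeasurableSet
    (hm R).nullMeasurableSet).trans (measureReal_mono ?_)
  intro p hp
  simp only [Set.mem_symmDiff, Set.mem_inter_iff] at hp ⊢
  tauto

end Halmos

end

/-! ### Recurrence together with mixing excludes independent factors. -/

section

variable {X : Type*} [MeasurableSpace X] {μ : Measure X}

/-- The times `t i` on the sets `D i` define a piecewise power of `S`: the sets `D i` are pairwise
disjoint, and so are their images. -/
structure IsPiecewisePower (S : Aut μ) (t : ℕ → ℕ) (D : ℕ → Set X) : Prop where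
  measurableSet : ∀ i, MeasurableSet (D i)
  disjoint : Pairwise (Function.onFun Disjoint D)
  disjoint_image : Pairwise (Function.onFun Disjoint fun i => S^[t i] '' D i)

/-- The automorphisms `R` that are mixing up to `1 / (n + 1)` on the sets `A k`, `k ≤ n`, along
finitely many times, and for which a piecewise power of `R` at these times nearly fixes the `A k`
and is defined on half of the space. -/
def recurrentMixing (A : ℕ → Set (X × X)) (S : Aut μ) (n : ℕ) : Set (Aut (μ.prod μ)) :=
  {R | ∃ (r : ℕ) (t : ℕ → ℕ) (D : ℕ → Set X), IsPiecewisePower S t D ∧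
    1 / 2 ≤ ∑ i ∈ Finset.range r, μ.real (D i) ∧ ∀ k ≤ n,
      (∀ i < r, (μ.prod μ).real (A k ∩ R^[t i] ⁻¹' A k) <
        (μ.prod μ).real (A k) ^ 2 + 1 / (n + 1)) ∧
      ∑ i ∈ Finset.range r, (μ.prod μ).real (D i ×ˢ Set.univ ∩ (A k ∆ (R^[t i] ⁻¹' A k))) <
        1 / (n + 1)}

theorem ae_iterate_fst_of_mem_Ext {S : Aut μ} {R : Aut (μ.prod μ)} (hR : R ∈ Ext S) (n : ℕ) :
    ∀ᵐ p ∂μ.prod μ, (R^[n] p).1 = S^[n] p.1 := by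
  obtain ⟨F, -, hF⟩ := hR
  induction n with
  | zero => simp
  | succ n ih =>
    filter_upwards [R.2.quasiMeasurePreserving.ae ih, hF] with p h1 h2
    rw [Function.iterate_succ_apply, Function.iterate_succ_apply]
    refine h1.trans ?_
    rw [h2]

variable [IsProbabilityMeasure μ]

/-- The witnesses `r`, `t`, `D` are constrained independently of `R`. For fixed witnesses there
remain finitely many strict inequalities between continuous functions of `R`. -/
theorem isOpen_recurrentMixing {A : ℕ → Set (X × X)}
    (hA : (μ.prod μ).MeasureDense (Set.range A)) (S : Aut μ) (n : ℕ) :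
    letI : PseudoMetricSpace (Aut (μ.prod μ)) := halmosMetric (μ.prod μ) A
    IsOpen (recurrentMixing A S n) := by
  let _ : PseudoMetricSpace (Aut (μ.prod μ)) := halmosMetric (μ.prod μ) A
  have hAm : ∀ k, MeasurableSet (A k) := fun k => hA.measurable _ ⟨k, rfl⟩
  have hset : recurrentMixing A S n = ⋃ (r : ℕ), ⋃ (t : ℕ → ℕ), ⋃ (D : ℕ → Set X),
      ⋃ (_ : IsPiecewisePower S t D ∧ 1 / 2 ≤ ∑ i ∈ Finset.range r, μ.real (D i)),
      ⋂ k ∈ Set.Iic n, ((⋂ i ∈ Set.Iio r, {R : Aut (μ.prod μ) | (μ.prod μ).real (A k ∩ R^[t i] ⁻¹' A k) <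
        (μ.prod μ).real (A k) ^ 2 + 1 / (n + 1)}) ∩
      {R : Aut (μ.prod μ) | ∑ i ∈ Finset.range r,
        (μ.prod μ).real (D i ×ˢ Set.univ ∩ (A k ∆ (R^[t i] ⁻¹' A k))) < 1 / (n + 1)}) := by
    ext R
    simp [recurrentMixing, and_assoc]
  rw [hset]
  refine isOpen_iUnion fun r => isOpen_iUnion fun t => isOpen_iUnion fun D =>
    isOpen_iUnion fun hD => (Set.finite_Iic n).isOpen_biInter fun k _ =>
      IsOpen.inter ((Set.finite_Iio r).isOpen_biInter fun i _ => ?_) ?_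
  · refine isOpen_lt ?_ continuous_const
    -- With `C = ∅` the symmetric difference is the preimage itself.
    simpa [Set.symmDiff_def] using
      continuous_measureReal_inter_symmDiff hA (t i) (hAm k) MeasurableSet.empty (hAm k)
  · exact isOpen_lt (continuous_finsetSum _ fun i _ => continuous_measureReal_inter_symmDiff hA
      (t i) (hAm k) (hAm k) ((hD.1.measurableSet i).prod MeasurableSet.univ)) continuous_const

theorem sum_measureReal_prod_univ_inter_le {D : ℕ → Set X} (hD : ∀ i, MeasurableSet (D i))
    (hd : Pairwise (Function.onFun Disjoint D)) (r : ℕ) {Y : Set (X × X)} (hY : MeasurableSet Y) :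
    ∑ i ∈ Finset.range r, (μ.prod μ).real (D i ×ˢ Set.univ ∩ Y) ≤ (μ.prod μ).real Y := by
  rw [← measureReal_biUnion_finset]
  · exact measureReal_mono (Set.iUnion₂_subset fun i _ => Set.inter_subset_right)
  · intro i _ j _ hij
    refine (Set.disjoint_left.2 ?_)
    intro p hp hq
    exact Set.disjoint_left.1 (hd hij) hp.1.1 hq.1.1
  · exact fun i _ => ((hD i).prod MeasurableSet.univ).inter hY

/-- A piecewise power of `R` moves sets that are close to each other by nearly the same amount. -/
theorem IsPiecewisePower.sum_symmDiff_le {S : Aut μ} {t : ℕ → ℕ} {D : ℕ → Set X}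
    (h : IsPiecewisePower S t D) {R : Aut (μ.prod μ)}
    (hR : ∀ n, ∀ᵐ p ∂μ.prod μ, (R^[n] p).1 = S^[n] p.1) (r : ℕ) {B C : Set (X × X)}
    (hB : MeasurableSet B) (hC : MeasurableSet C) :
    ∑ i ∈ Finset.range r, (μ.prod μ).real (D i ×ˢ Set.univ ∩ (B ∆ (R^[t i] ⁻¹' B))) ≤
      ∑ i ∈ Finset.range r, (μ.prod μ).real (D i ×ˢ Set.univ ∩ (C ∆ (R^[t i] ⁻¹' C))) +
        2 * (μ.prod μ).real (B ∆ C) := by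
  have hBC := hB.symmDiff hC
  have h1 := sum_measureReal_prod_univ_inter_le (μ := μ) h.measurableSet h.disjoint r hBC
  have h2 := sum_measureReal_prod_univ_inter_le (μ := μ)
    (fun i => S.measurableSet_iterate_image (t i) (h.measurableSet i)) h.disjoint_image r hBC
  -- `R^[t i]` carries the part over `D i` into the part over `S^[t i] '' D i`; the disjointness of
  -- these images keeps the total error at one copy of `B ∆ C`.
  have h3 : ∀ i, (μ.prod μ).real (D i ×ˢ Set.univ ∩ (R^[t i] ⁻¹' (B ∆ C))) ≤
      (μ.prod μ).real ((S^[t i] '' D i) ×ˢ Set.univ ∩ (B ∆ C)) := by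
    intro i
    rw [← R.measureReal_iterate_preimage (t i) ((S^[t i] '' D i) ×ˢ Set.univ ∩ (B ∆ C))]
    refine ENNReal.toReal_mono (measure_ne_top _ _) (measure_mono_ae ?_)
    filter_upwards [hR (t i)] with p hp hpD
    exact ⟨⟨⟨p.1, hpD.1.1, hp.symm⟩, Set.mem_univ _⟩, hpD.2⟩
  have h4 : ∀ i, (μ.prod μ).real (D i ×ˢ Set.univ ∩ (B ∆ (R^[t i] ⁻¹' B))) ≤
      (μ.prod μ).real (D i ×ˢ Set.univ ∩ (C ∆ (R^[t i] ⁻¹' C))) +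
        (μ.prod μ).real (D i ×ˢ Set.univ ∩ (B ∆ C)) +
        (μ.prod μ).real (D i ×ˢ Set.univ ∩ (R^[t i] ⁻¹' (B ∆ C))) := by
    intro i
    refine (measureReal_mono ?_).trans ((measureReal_union_le
      (D i ×ˢ Set.univ ∩ (C ∆ (R^[t i] ⁻¹' C)) ∪ D i ×ˢ Set.univ ∩ (B ∆ C)) _).trans
      (add_le_add_left (measureReal_union_le _ _) _))
    intro p hp
    simp only [Set.mem_symmDiff, Set.mem_inter_iff, Set.mem_union, Set.mem_preimage] at hp ⊢
    tauto
  calc _ ≤ _ := Finset.sum_le_sum fun i _ => h4 i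
    _ ≤ _ := by
      rw [Finset.sum_add_distrib, Finset.sum_add_distrib]
      have := Finset.sum_le_sum fun i (_ : i ∈ Finset.range r) => h3 i
      linarith

/-- A set that is independent of the base together with all its displacements is trivial. -/
theorem false_of_mem_recurrentMixing {A : ℕ → Set (X × X)}
    (hA : (μ.prod μ).MeasureDense (Set.range A)) {S : Aut μ} {R : Aut (μ.prod μ)}
    (hR : R ∈ Ext S) (hG : ∀ n, R ∈ recurrentMixing A S n) {E : Set (X × X)}
    (hEm : MeasurableSet E) (hindep : ∀ (t : ℕ) (D : Set X), MeasurableSet D →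
      (μ.prod μ).real (D ×ˢ Set.univ ∩ (E ∆ (R^[t] ⁻¹' E))) =
        μ.real D * (μ.prod μ).real (E ∆ (R^[t] ⁻¹' E)))
    (ha0 : 0 < (μ.prod μ).real E) (ha1 : (μ.prod μ).real E < 1) : False := by
  set a := (μ.prod μ).real E with ha
  set δ := a * (1 - a) / 20 with hδ
  have hδ0 : 0 < δ := by
    have : 0 < 1 - a := by linarith
    positivity
  obtain ⟨k, hk⟩ := exists_approx hA hEm hδ0
  have hAm : MeasurableSet (A k) := hA.measurable _ ⟨k, rfl⟩
  obtain ⟨N, hN⟩ := exists_nat_one_div_lt hδ0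
  set n := max k N with hn
  have hnδ : 1 / ((n : ℝ) + 1) < δ := by
    refine lt_of_le_of_lt ?_ hN
    have : (N : ℝ) ≤ n := by exact_mod_cast le_max_right k N
    gcongr
  obtain ⟨r, t, D, hD, hhalf, hk'⟩ := hG n
  obtain ⟨hmix, hret⟩ := hk' k (le_max_left _ _)
  have hsum := hD.sum_symmDiff_le (ae_iterate_fst_of_mem_Ext hR) r hEm hAm
  have hAk : (μ.prod μ).real (A k) ≤ a + δ := by
    have h1 : (μ.prod μ).real (A k) ≤ (μ.prod μ).real E + (μ.prod μ).real (E ∆ A k) := by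
      refine (measureReal_mono ?_).trans (measureReal_union_le _ _)
      intro p hp
      simp only [Set.mem_symmDiff, Set.mem_union]
      tauto
    linarith
  have hAk2 : (μ.prod μ).real (A k) ^ 2 ≤ a ^ 2 + 2 * δ := by
    have h1 : (μ.prod μ).real (A k) ≤ 1 := measureReal_le_one
    have h2 : 0 ≤ (μ.prod μ).real (A k) := measureReal_nonneg
    nlinarith
  -- Mixing gives `A k ∩ R^[t i] ⁻¹' A k` measure below `a² + 3δ`; passing from `A k` to `E` costs
  -- `2δ` more, and the symmetric difference doubles the total `5δ`.
  have hlow : ∀ i < r, 2 * a - 2 * a ^ 2 - 10 * δ ≤ (μ.prod μ).real (E ∆ (R^[t i] ⁻¹' E)) := by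
    intro i hi
    have h1 : (μ.prod μ).real (E ∩ R^[t i] ⁻¹' E) ≤
        (μ.prod μ).real (A k ∩ R^[t i] ⁻¹' A k) + (μ.prod μ).real (E ∆ A k) + (μ.prod μ).real (R^[t i] ⁻¹' (E ∆ A k)) := by
      refine (measureReal_mono ?_).trans ((measureReal_union_le
        (A k ∩ R^[t i] ⁻¹' A k ∪ E ∆ A k) _).trans (add_le_add_left (measureReal_union_le _ _) _))
      intro p hp
      simp only [Set.mem_symmDiff, Set.mem_inter_iff, Set.mem_union, Set.mem_preimage] at hp ⊢
      tauto
    rw [R.measureReal_iterate_preimage] at h1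
    have hm' : MeasurableSet (R^[t i] ⁻¹' E) := (R.measurable.iterate _) hEm
    have h2 : (μ.prod μ).real (E ∆ (R^[t i] ⁻¹' E)) =
        (μ.prod μ).real (E \ R^[t i] ⁻¹' E) + (μ.prod μ).real (R^[t i] ⁻¹' E \ E) := by
      rw [Set.symmDiff_def, measureReal_union (disjoint_sdiff_sdiff) (hm'.diff hEm)]
    have h3 := measureReal_inter_add_sdiff (μ := μ.prod μ) (s := E) hm'
    have h4 := measureReal_inter_add_sdiff (μ := μ.prod μ) (s := R^[t i] ⁻¹' E) hEm
    rw [R.measureReal_iterate_preimage, Set.inter_comm] at h4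
    have h5 := hmix i hi
    linarith
  have hlow0 : 0 ≤ 2 * a - 2 * a ^ 2 - 10 * δ := by nlinarith
  have h6 : 1 / 2 * (2 * a - 2 * a ^ 2 - 10 * δ) ≤
      ∑ i ∈ Finset.range r, (μ.prod μ).real (D i ×ˢ Set.univ ∩ (E ∆ (R^[t i] ⁻¹' E))) := by
    calc _ ≤ (∑ i ∈ Finset.range r, μ.real (D i)) * (2 * a - 2 * a ^ 2 - 10 * δ) :=
          mul_le_mul_of_nonneg_right hhalf hlow0
      _ ≤ _ := by
        rw [Finset.sum_mul]
        refine Finset.sum_le_sum fun i hi => ?_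
        rw [hindep _ _ (hD.measurableSet i)]
        exact mul_le_mul_of_nonneg_left (hlow i (Finset.mem_range.1 hi)) measureReal_nonneg
  nlinarith


theorem not_hasNontrivialIndepFactor {A : ℕ → Set (X × X)}
    (hA : (μ.prod μ).MeasureDense (Set.range A)) {S : Aut μ} {R : Aut (μ.prod μ)}
    (hR : R ∈ Ext S) (hG : ∀ n, R ∈ recurrentMixing A S n) : ¬ HasNontrivialIndepFactor R := by
  rintro ⟨m, ⟨hm, hinv⟩, htriv, hind⟩
  obtain ⟨E, hE, hE0, hE1⟩ :
      ∃ E, MeasurableSet[m] E ∧ μ.prod μ E ≠ 0 ∧ μ.prod μ E ≠ 1 := by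
    simpa [IsTrivialFactor] using htriv
  have hinvm : ∀ t : ℕ, MeasurableSet[m] (R^[t] ⁻¹' E) := by
    intro t
    induction t with
    | zero => exact hE
    | succ t ih =>
      rw [Function.iterate_succ, Set.preimage_comp]
      have h : MeasurableSet[m.comap R] (R ⁻¹' (R^[t] ⁻¹' E)) := ⟨_, ih, rfl⟩
      rwa [hinv] at h
  refine false_of_mem_recurrentMixing hA hR hG (hm _ hE) (fun t D hD => ?_)
    (ENNReal.toReal_pos hE0 (measure_ne_top _ _)) (lt_of_le_of_ne measureReal_le_one fun h =>
      hE1 ((ENNReal.toReal_eq_one_iff _).1 h))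
  have h1 : MeasurableSet[m] (E ∆ (R^[t] ⁻¹' E)) := @MeasurableSet.symmDiff _ m _ _ hE (hinvm t)
  have h2 : MeasurableSet[baseFactor X] (D ×ˢ (Set.univ : Set X)) := ⟨D, hD, by ext p; simp⟩
  have h3 := (Indep_iff m (baseFactor X) (μ.prod μ)).1 hind _ _ h1 h2
  rw [Set.inter_comm, measureReal_def, h3, ENNReal.toReal_mul, mul_comm, Measure.prod_prod]
  simp [measureReal_def]

end

section

/-! ### Mixing sequences and piecewise powers preserving a partition. -/

section Mixing

variable {X : Type*} [MeasurableSpace X] {μ : Measure X}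

/-- `S` is mixing along the sequence `j`. -/
def IsMixingSeq (S : Aut μ) (j : ℕ → ℕ) : Prop :=
  ∀ A B : Set X, MeasurableSet A → MeasurableSet B →
    Tendsto (fun k => μ (A ∩ S^[j k] '' B)) atTop (𝓝 (μ A * μ B))

theorem IsMixingSeq.comp_add {S : Aut μ} {j : ℕ → ℕ} (h : IsMixingSeq S j) (m : ℕ) :
    IsMixingSeq S (fun i => j (i + m)) :=
  fun A B hA hB => (h A B hA hB).comp (tendsto_add_atTop_nat m)

/-- All the intersections in the mixing limit are empty, so the limit `μ A * μ B` is zero. -/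
theorem IsMixingSeq.measure_eq_zero {S : Aut μ} {j : ℕ → ℕ} (h : IsMixingSeq S j)
    {A B : Set X} (hA : MeasurableSet A) (hB : MeasurableSet B)
    (hAB : ∀ i, ∀ x ∈ B, S^[j i] x ∉ A) : μ A = 0 ∨ μ B = 0 := by
  rw [← mul_eq_zero]
  refine tendsto_nhds_unique (h A B hA hB) ?_
  refine tendsto_const_nhds.congr fun i => ?_
  rw [eq_comm, show A ∩ S^[j i] '' B = ∅ from ?_, measure_empty]
  ext x
  simp only [Set.mem_inter_iff, Set.mem_image, Set.mem_empty_iff_false, iff_false, not_and]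
  rintro hx ⟨y, hy, rfl⟩
  exact hAB i y hy hx

theorem Aut.iterate_symm_iterate (S : Aut μ) (n : ℕ) (x : X) : S.symm^[n] (S^[n] x) = x :=
  Function.LeftInverse.iterate S.symm_apply_apply n x

theorem Aut.iterate_iterate_symm (S : Aut μ) (n : ℕ) (x : X) : S^[n] (S.symm^[n] x) = x :=
  Function.LeftInverse.iterate (show Function.LeftInverse S S.symm from S.apply_symm_apply) n x

/-- Almost every point has visited a given set of positive measure. -/
theorem IsMixingSeq.ae_exists_mem {S : Aut μ} {j : ℕ → ℕ} (h : IsMixingSeq S j)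
    {E : Set X} (hE : MeasurableSet E) (h0 : μ E ≠ 0) : ∀ᵐ x ∂μ, ∃ n, S.symm^[n] x ∈ E := by
  have hm : MeasurableSet {x | ∃ n, S.symm^[n] x ∈ E} := by
    rw [Set.ofPred_exists]
    exact MeasurableSet.iUnion fun n => (S.symm.measurable.iterate n) hE
  refine (h.measure_eq_zero hm.compl hE fun i x hx => ?_).resolve_right h0
  simp only [Set.mem_compl_iff, not_not]
  exact ⟨j i, by rwa [S.iterate_symm_iterate]⟩

/-- A piecewise power of `S` with times in a mixing sequence that preserves the partition given by
`c`, and is defined on half of the space. -/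
theorem IsMixingSeq.exists_isPiecewisePower [IsProbabilityMeasure μ] {S : Aut μ} {t : ℕ → ℕ}
    (h : IsMixingSeq S t)
    {ι : Type*} [Countable ι] [MeasurableSpace ι] [MeasurableSingletonClass ι] {c : X → ι}
    (hc : Measurable c) : ∃ (r : ℕ) (D : ℕ → Set X), IsPiecewisePower S t D ∧
      (∀ i, ∀ x ∈ D i, c x = c (S^[t i] x)) ∧ 1 / 2 ≤ ∑ i ∈ Finset.range r, μ.real (D i) := by
  -- A greedy construction: the pair `q` records the domain and range already used, and at time `t
  -- i` every point is taken that returns to its own cell and is unused, with unused image.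
  set d : ℕ → Set X × Set X → Set X := fun i q =>
    {x | c x = c (S^[t i] x)} \ (q.1 ∪ S^[t i] ⁻¹' q.2) with hd
  set st : ℕ → Set X × Set X := fun i =>
    Nat.rec (∅, ∅) (fun i q => (q.1 ∪ d i q, q.2 ∪ S^[t i] '' d i q)) i with hst
  have st_succ : ∀ i, st (i + 1) = ((st i).1 ∪ d i (st i), (st i).2 ∪ S^[t i] '' d i (st i)) :=
    fun i => rfl
  set D : ℕ → Set X := fun i => d i (st i) with hD
  have hdm : ∀ i q, MeasurableSet q.1 → MeasurableSet q.2 → MeasurableSet (d i q) := by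
    intro i q h1 h2
    have hS := S.measurable.iterate (t i)
    exact (measurableSet_eq_fun hc (hc.comp hS)).diff (h1.union (hS h2))
  have hstm : ∀ i, MeasurableSet (st i).1 ∧ MeasurableSet (st i).2 := by
    intro i
    induction i with
    | zero => exact ⟨MeasurableSet.empty, MeasurableSet.empty⟩
    | succ i ih =>
      have := hdm i _ ih.1 ih.2
      rw [st_succ]
      exact ⟨ih.1.union this, ih.2.union (S.measurableSet_iterate_image _ this)⟩
  have hDm : ∀ i, MeasurableSet (D i) := fun i => hdm i _ (hstm i).1 (hstm i).2
  have hstU : ∀ i, (st i).1 = ⋃ l < i, D l := by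
    intro i
    induction i with
    | zero => simp [hst]
    | succ i ih =>
      rw [st_succ, Set.biUnion_lt_succ, ← ih]
  have hstV : ∀ i, (st i).2 = ⋃ l < i, S^[t l] '' D l := by
    intro i
    induction i with
    | zero => simp [hst]
    | succ i ih =>
      rw [st_succ, Set.biUnion_lt_succ, ← ih]
  have hdisj : Pairwise (Function.onFun Disjoint D) := by
    refine (pairwise_disjoint_on D).2 fun i l hil => Set.disjoint_left.2 fun x hx hxl => ?_
    refine hxl.2 (Or.inl ?_)
    rw [hstU]
    exact Set.mem_iUnion₂.2 ⟨_, hil, hx⟩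
  have hdisjV : Pairwise (Function.onFun Disjoint fun i => S^[t i] '' D i) := by
    refine (pairwise_disjoint_on _).2 fun i l hil => Set.disjoint_left.2 ?_
    rintro _ hx ⟨x, hxl, rfl⟩
    refine hxl.2 (Or.inr ?_)
    rw [Set.mem_preimage, hstV]
    exact Set.mem_iUnion₂.2 ⟨_, hil, hx⟩
  have hcell : ∀ i, ∀ x ∈ D i, c x = c (S^[t i] x) := fun i x hx => hx.1
  set U := ⋃ i, D i with hU
  set V := ⋃ i, S^[t i] '' D i with hV
  have hUm : MeasurableSet U := MeasurableSet.iUnion hDm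
  have hVm : MeasurableSet V :=
    MeasurableSet.iUnion fun i => S.measurableSet_iterate_image _ (hDm i)
  -- Within a cell, the piecewise power maps the used domain onto the used range, so the two
  -- leftovers have equal measure. By greediness no time `t i` moves a leftover domain point to a
  -- leftover range point, so mixing makes one of them, hence both, null.
  have hz : ∀ z, μ (c ⁻¹' {z} \ U) = 0 := by
    intro z
    have hcz : MeasurableSet (c ⁻¹' {z}) := hc (measurableSet_singleton z)
    have hUV : μ (c ⁻¹' {z} ∩ U) = μ (c ⁻¹' {z} ∩ V) := by
      rw [hU, hV, Set.inter_iUnion, Set.inter_iUnion, measure_iUnion, measure_iUnion]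
      · refine tsum_congr fun i => ?_
        rw [← S.measure_iterate_image (t i) (c ⁻¹' {z} ∩ D i)]
        congr 1
        ext y
        constructor
        · rintro ⟨x, ⟨hx1, hx2⟩, rfl⟩
          exact ⟨(hcell i x hx2).symm.trans hx1, x, hx2, rfl⟩
        · rintro ⟨hy, x, hx, rfl⟩
          exact ⟨x, ⟨(hcell i x hx).trans hy, hx⟩, rfl⟩
      · exact fun i l hil => (hdisjV hil).mono Set.inter_subset_right Set.inter_subset_right
      · exact fun i => hcz.inter (S.measurableSet_iterate_image _ (hDm i))
      · exact fun i l hil => (hdisj hil).mono Set.inter_subset_right Set.inter_subset_right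
      · exact fun i => hcz.inter (hDm i)
    have heq : μ (c ⁻¹' {z} \ U) = μ (c ⁻¹' {z} \ V) := by
      have h1 := measure_inter_add_sdiff (μ := μ) (c ⁻¹' {z}) hUm
      have h2 := measure_inter_add_sdiff (μ := μ) (c ⁻¹' {z}) hVm
      rw [hUV, ← h2] at h1
      exact (ENNReal.add_right_inj (measure_ne_top _ _)).1 h1
    have hesc : ∀ i, ∀ x ∈ c ⁻¹' {z} \ U, S^[t i] x ∉ c ⁻¹' {z} \ V := by
      intro i x hx hx'
      refine hx.2 (Set.mem_iUnion.2 ⟨i, Eq.trans hx.1 (Eq.symm hx'.1), ?_⟩)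
      rintro (hxU | hxV)
      · rw [hstU] at hxU
        exact hx.2 (Set.iUnion₂_subset (fun l _ => Set.subset_iUnion D l) hxU)
      · rw [Set.mem_preimage, hstV] at hxV
        exact hx'.2 (Set.iUnion₂_subset
          (fun l _ => Set.subset_iUnion (fun l => S^[t l] '' D l) l) hxV)
    rcases h.measure_eq_zero (hcz.diff hVm) (hcz.diff hUm) hesc with h1 | h1
    · exact heq.trans h1
    · exact h1
  have hUc : μ Uᶜ = 0 := by
    rw [show Uᶜ = ⋃ z, c ⁻¹' {z} \ U by ext x; simp]
    exact measure_iUnion_null hz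
  have hU1 : μ U = 1 := (prob_compl_eq_zero_iff hUm).1 hUc
  have hsum : HasSum (fun i => μ.real (D i)) 1 := by
    have h1 : ∑' i, μ (D i) = 1 := by rw [← measure_iUnion hdisj hDm, ← hU1]
    have h2 := (ENNReal.hasSum_toReal (f := fun i => μ (D i)) (by rw [h1]; simp))
    rwa [← ENNReal.tsum_toReal_eq (fun i => measure_ne_top _ _), h1, ENNReal.toReal_one] at h2
  obtain ⟨r, hr⟩ := (hsum.tendsto_sum_nat.eventually_const_lt
    (show (1 / 2 : ℝ) < 1 by norm_num)).exists
  exact ⟨r, D, ⟨hDm, hdisj, hdisjV⟩, hcell, hr.le⟩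

end Mixing

/-! ### Finite partitions into small cells. -/

section Cells

variable {X : Type*} [MeasurableSpace X]

/-- The first `N` bits of a point. -/
noncomputable def bits [MeasurableSpace.CountablyGenerated X] (N : ℕ) (x : X) : Fin N → Bool :=
  fun i => MeasurableSpace.mapNatBool X x i

theorem measurable_bits [MeasurableSpace.CountablyGenerated X] (N : ℕ) :
    Measurable (bits (X := X) N) :=
  measurable_pi_lambda _ fun i => (measurable_pi_apply (i : ℕ)).comp
    (MeasurableSpace.measurable_mapNatBool X)

variable [StandardBorelSpace X] {μ : Measure X} [IsProbabilityMeasure μ]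

/-- The sets decrease to `{p | b p.1 = b p.2}`, since the bits separate points; this limit is null
by Fubini. -/
theorem tendsto_measure_bits_eq {b : X → X} (hb : Measurable b)
    (h0 : ∀ z, μ (b ⁻¹' {z}) = 0) :
    Tendsto (fun N => (μ.prod μ) {p | bits N (b p.1) = bits N (b p.2)}) atTop (𝓝 0) := by
  have hm : ∀ N, MeasurableSet {p : X × X | bits N (b p.1) = bits N (b p.2)} := fun N =>
    measurableSet_eq_fun ((measurable_bits N).comp (hb.comp measurable_fst))
      ((measurable_bits N).comp (hb.comp measurable_snd))
  have hanti : Antitone fun N => {p : X × X | bits N (b p.1) = bits N (b p.2)} := by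
    intro M N hMN p hp
    funext i
    exact congrFun hp (Fin.castLE hMN i)
  have hlim := tendsto_measure_iInter_atTop (μ := μ.prod μ)
    (fun N => (hm N).nullMeasurableSet) hanti ⟨0, measure_ne_top _ _⟩
  have hset : ⋂ N, {p : X × X | bits N (b p.1) = bits N (b p.2)} = {p | b p.1 = b p.2} := by
    ext p
    simp only [Set.mem_iInter, Set.mem_ofPred_eq]
    refine ⟨fun h => MeasurableSpace.injective_mapNatBool X ?_, fun h N => by rw [h]⟩
    funext i
    exact congrFun (h (i + 1)) (Fin.last i)
  have hnull : (μ.prod μ) {p | b p.1 = b p.2} = 0 := by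
    have hme : MeasurableSet {p : X × X | b p.1 = b p.2} :=
      measurableSet_eq_fun (hb.comp measurable_fst) (hb.comp measurable_snd)
    rw [Measure.prod_apply hme]
    refine (lintegral_congr fun x => ?_).trans lintegral_zero
    rw [← h0 (b x)]
    congr 1
    ext y
    simp [eq_comm]
  rwa [hset, hnull] at hlim

variable [NullSingletonClass μ]

/-- Otherwise every cell would be null or have measure at least `ε`, so a random pair would share a
cell with probability at least `ε`, for every number of bits. -/
theorem exists_measure_pos_lt {ε : ℝ≥0∞} (hε : 0 < ε) :
    ∃ E, MeasurableSet E ∧ μ E ≠ 0 ∧ μ E < ε := by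
  obtain ⟨N, hN⟩ := ((tendsto_measure_bits_eq (μ := μ) (b := id) measurable_id
    (fun z => by simp)).eventually_lt_const hε).exists
  have hm : MeasurableSet {p : X × X | bits N p.1 = bits N p.2} :=
    measurableSet_eq_fun ((measurable_bits N).comp measurable_fst)
      ((measurable_bits N).comp measurable_snd)
  simp only [id] at hN
  rw [Measure.prod_apply hm] at hN
  by_contra! hcon
  have hcell : ∀ z : Fin N → Bool, μ (bits N ⁻¹' {z}) < ε → μ (bits N ⁻¹' {z}) = 0 := by
    intro z hz
    by_contra h
    exact hz.not_ge (hcon _ ((measurable_bits N) (measurableSet_singleton z)) h)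
  have hae : ∀ᵐ x ∂μ, ε ≤ μ (Prod.mk x ⁻¹' {p : X × X | bits N p.1 = bits N p.2}) := by
    have hsub : {x | ¬ ε ≤ μ (Prod.mk x ⁻¹' {p : X × X | bits N p.1 = bits N p.2})} ⊆
        ⋃ z : {z : Fin N → Bool // μ (bits N ⁻¹' {z}) < ε}, bits N ⁻¹' {z.1} := by
      intro x hx
      have he : Prod.mk x ⁻¹' {p : X × X | bits N p.1 = bits N p.2} = bits N ⁻¹' {bits N x} := by
        ext y; simp [eq_comm]
      simp only [Set.mem_ofPred_eq, not_le, he] at hx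
      exact Set.mem_iUnion.2 ⟨⟨_, hx⟩, rfl⟩
    exact measure_mono_null hsub (measure_iUnion_null fun z => hcell z.1 z.2)
  have := lintegral_mono_ae hae
  rw [lintegral_const, measure_univ, mul_one] at this
  exact this.not_gt hN

end Cells

/-! ### Approximation by sets with countably many sections. -/

section Simple

variable {X : Type*} [MeasurableSpace X] {μ : Measure X} [IsProbabilityMeasure μ]

/-- Every measurable set in the product is close to one with countably many different sections. -/
theorem exists_countable_sections {B : Set (X × X)} (hB : MeasurableSet B) {ε : ℝ}
    (hε : 0 < ε) : ∃ C : Set (X × X), MeasurableSet C ∧ (μ.prod μ).real (B ∆ C) < ε ∧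
      ∃ c : X → ℕ, Measurable c ∧ ∀ x x' y, c x = c x' → ((x, y) ∈ C ↔ (x', y) ∈ C) := by
  classical
  -- These sets form an algebra containing the rectangles, hence are dense; unions are handled by
  -- the common refinement of two labellings, coded by `Nat.pair`.
  set 𝒜 : Set (Set (X × X)) := {C | MeasurableSet C ∧
    ∃ c : X → ℕ, Measurable c ∧ ∀ x x' y, c x = c x' → ((x, y) ∈ C ↔ (x', y) ∈ C)} with h𝒜
  have halg : IsSetAlgebra 𝒜 := by
    refine ⟨⟨MeasurableSet.empty, 0, measurable_const, by simp⟩, ?_, ?_⟩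
    · rintro C ⟨hC, c, hc, h⟩
      exact ⟨hC.compl, c, hc, fun x x' y hx => not_congr (h x x' y hx)⟩
    · rintro C C' ⟨hC, c, hc, h⟩ ⟨hC', c', hc', h'⟩
      refine ⟨hC.union hC', fun x => Nat.pair (c x) (c' x), ?_, fun x x' y hx => ?_⟩
      · exact (measurable_of_countable (fun q : ℕ × ℕ => Nat.pair q.1 q.2)).comp (hc.prodMk hc')
      · obtain ⟨h1, h2⟩ := Nat.pair_eq_pair.1 hx
        exact or_congr (h x x' y h1) (h' x x' y h2)
  have hgen : (Prod.instMeasurableSpace : MeasurableSpace (X × X)) =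
      MeasurableSpace.generateFrom 𝒜 := by
    refine le_antisymm ?_ (MeasurableSpace.generateFrom_le fun C hC => hC.1)
    rw [← generateFrom_prod]
    refine MeasurableSpace.generateFrom_mono ?_
    rintro _ ⟨U, hU, V, hV, rfl⟩
    refine ⟨MeasurableSet.prod hU hV, fun x => if x ∈ U then 1 else 0,
      Measurable.ite hU measurable_const measurable_const, fun x x' y hx => ?_⟩
    by_cases h1 : x ∈ U <;> by_cases h2 : x' ∈ U <;> simp_all
  have hdense := Measure.MeasureDense.of_generateFrom_isSetAlgebra_finite (μ.prod μ) halg hgen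
  obtain ⟨C, hC, hBC⟩ := hdense.approx B hB (measure_ne_top _ _) ε hε
  refine ⟨C, hC.1, ?_, hC.2⟩
  rw [measureReal_def]
  exact (ENNReal.lt_ofReal_iff_toReal_lt (measure_ne_top _ _)).1 hBC

end Simple

end

/-! ### Decorrelating sections by powers of `S`. -/

section

variable {X : Type*} [MeasurableSpace X] {μ : Measure X}

/-- The measure of the intersection of the translates by `S ^ a` and `S ^ b` of the sections of `B`
over `p.1` and `p.2`. -/
noncomputable def sectionCorr (S : Aut μ) (B : Set (X × X)) (a b : ℕ) (p : X × X) : ℝ≥0∞ :=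
  μ {y | (p.1, (S.iter a).symm y) ∈ B ∧ (p.2, (S.iter b).symm y) ∈ B}

theorem sectionCorr_swap (S : Aut μ) (B : Set (X × X)) (a b : ℕ) (p : X × X) :
    sectionCorr S B a b p.swap = sectionCorr S B b a p := by
  simp only [sectionCorr, Prod.fst_swap, Prod.snd_swap, and_comm]

theorem measurableSet_snd_section {B : Set (X × X)} (hB : MeasurableSet B) (x : X) :
    MeasurableSet {y | (x, y) ∈ B} := measurable_prodMk_left hB

theorem measurableSet_fst_section {B : Set (X × X)} (hB : MeasurableSet B) (y : X) :
    MeasurableSet {x | (x, y) ∈ B} := measurable_prodMk_right hB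

theorem IsMixingSeq.tendsto_sectionCorr {S : Aut μ} {j : ℕ → ℕ} (h : IsMixingSeq S j)
    {B : Set (X × X)} (hB : MeasurableSet B) (a : ℕ) (p : X × X) :
    Tendsto (fun m => sectionCorr S B a (j m) p) atTop
      (𝓝 (μ {y | (p.1, y) ∈ B} * μ {y | (p.2, y) ∈ B})) := by
  have h1 := h ((S.iter a).symm ⁻¹' {y | (p.1, y) ∈ B}) {y | (p.2, y) ∈ B}
    ((S.iter a).symm.measurable (measurableSet_snd_section hB _)) (measurableSet_snd_section hB _)
  rw [Aut.measure_preimage] at h1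
  refine h1.congr fun m => ?_
  rw [← S.iter_coe, Aut.image_eq]
  rfl

variable [IsProbabilityMeasure μ]

theorem measurable_sectionCorr (S : Aut μ) {B : Set (X × X)} (hB : MeasurableSet B) (a b : ℕ) :
    Measurable (sectionCorr S B a b) := by
  have hm : MeasurableSet {q : (X × X) × X |
      (q.1.1, (S.iter a).symm q.2) ∈ B ∧ (q.1.2, (S.iter b).symm q.2) ∈ B} := by
    refine MeasurableSet.inter ?_ ?_
    · exact ((measurable_fst.comp measurable_fst).prodMk
        ((S.iter a).symm.measurable.comp measurable_snd)) hB
    · exact ((measurable_snd.comp measurable_fst).prodMk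
        ((S.iter b).symm.measurable.comp measurable_snd)) hB
  exact measurable_measure_prodMk_left hm

theorem sectionCorr_le_one (S : Aut μ) (B : Set (X × X)) (a b : ℕ) (p : X × X) :
    sectionCorr S B a b p ≤ 1 := prob_le_one

theorem tendsto_setLIntegral_of_le_one {f : ℕ → X × X → ℝ≥0∞} {g : X × X → ℝ≥0∞}
    {ν : Measure (X × X)} [IsFiniteMeasure ν] (hf : ∀ m, Measurable (f m))
    (h1 : ∀ m p, f m p ≤ 1) (h : ∀ p, Tendsto (fun m => f m p) atTop (𝓝 (g p))) (Q : Set (X × X)) :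
    Tendsto (fun m => ∫⁻ p in Q, f m p ∂ν) atTop (𝓝 (∫⁻ p in Q, g p ∂ν)) :=
  tendsto_lintegral_of_dominated_convergence 1 hf (fun m => Eventually.of_forall (h1 m))
    (by simp) (Eventually.of_forall h)

theorem IsMixingSeq.tendsto_lintegral_sectionCorr {S : Aut μ} {j : ℕ → ℕ} (h : IsMixingSeq S j)
    {B : Set (X × X)} (hB : MeasurableSet B) (a : ℕ) (Q : Set (X × X)) :
    Tendsto (fun m => ∫⁻ p in Q, sectionCorr S B a (j m) p ∂μ.prod μ) atTop
      (𝓝 (∫⁻ p in Q, μ {y | (p.1, y) ∈ B} * μ {y | (p.2, y) ∈ B} ∂μ.prod μ)) ∧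
    Tendsto (fun m => ∫⁻ p in Q, sectionCorr S B (j m) a p ∂μ.prod μ) atTop
      (𝓝 (∫⁻ p in Q, μ {y | (p.1, y) ∈ B} * μ {y | (p.2, y) ∈ B} ∂μ.prod μ)) := by
  constructor
  · exact tendsto_setLIntegral_of_le_one (fun m => measurable_sectionCorr S hB _ _)
      (fun m p => sectionCorr_le_one _ _ _ _ _) (h.tendsto_sectionCorr hB a) Q
  · refine tendsto_setLIntegral_of_le_one (fun m => measurable_sectionCorr S hB _ _)
      (fun m p => sectionCorr_le_one _ _ _ _ _) (fun p => ?_) Q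
    simpa [sectionCorr_swap, mul_comm] using h.tendsto_sectionCorr hB a p.swap

theorem lintegral_section_mul_section {B : Set (X × X)} (hB : MeasurableSet B) :
    ∫⁻ p, μ {y | (p.1, y) ∈ B} * μ {y | (p.2, y) ∈ B} ∂μ.prod μ = (μ.prod μ B) ^ 2 := by
  have hm : Measurable fun x => μ {y | (x, y) ∈ B} := measurable_measure_prodMk_left hB
  rw [lintegral_prod_mul (f := fun x => μ {y | (x, y) ∈ B}) (g := fun x => μ {y | (x, y) ∈ B})
    hm.aemeasurable hm.aemeasurable, sq, Measure.prod_apply hB]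
  rfl

theorem lintegral_eq_sum_fiber {Ω κ : Type*} [MeasurableSpace Ω] (ν : Measure Ω) [Fintype κ]
    [MeasurableSpace κ] [MeasurableSingletonClass κ] {f : Ω → κ} (hf : Measurable f)
    (g : Ω → ℝ≥0∞) : ∫⁻ p, g p ∂ν = ∑ q, ∫⁻ p in f ⁻¹' {q}, g p ∂ν := by
  rw [← tsum_fintype (L := .unconditional _), ← lintegral_iUnion (fun q => hf (measurableSet_singleton q))]
  · rw [← Set.preimage_iUnion, Set.iUnion_of_singleton, Set.preimage_univ, setLIntegral_univ]
  · exact fun q q' hq => (Set.disjoint_singleton.2 hq).preimage f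

/-- Translating the sections of `B` over the cells of a partition by suitable powers of `S` makes
them nearly independent of each other. -/
theorem IsMixingSeq.exists_lintegral_sectionCorr_le {S : Aut μ} {j : ℕ → ℕ} (h : IsMixingSeq S j)
    {ι : Type*} [Fintype ι] [MeasurableSpace ι] [MeasurableSingletonClass ι] {c : X → ι}
    (hc : Measurable c) {B : ℕ → Set (X × X)} (hB : ∀ k, MeasurableSet (B k)) (n : ℕ)
    {δ : ℝ≥0∞} (hδ : 0 < δ) : ∃ s : ι → ℕ, ∀ k ≤ n,
      ∫⁻ p, sectionCorr S (B k) (s (c p.1)) (s (c p.2)) p ∂μ.prod μ ≤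
        (μ.prod μ) {p | c p.1 = c p.2} + (μ.prod μ (B k)) ^ 2 + δ := by
  classical
  set T : X × X → ι × ι := fun p => (c p.1, c p.2) with hT
  have hTm : Measurable T := (hc.comp measurable_fst).prodMk (hc.comp measurable_snd)
  set η : ℝ≥0∞ := δ / Fintype.card (ι × ι) with hη
  have hη0 : η ≠ 0 := (ENNReal.div_pos hδ.ne' (ENNReal.natCast_ne_top _)).ne'
  set I : ℕ → ι × ι → ℝ≥0∞ := fun k q =>
    ∫⁻ p in T ⁻¹' {q}, μ {y | (p.1, y) ∈ B k} * μ {y | (p.2, y) ∈ B k} ∂μ.prod μ with hI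
  have hItop : ∀ k q, I k q ≠ ⊤ := by
    intro k q
    refine ((lintegral_mono (g := 1) fun p => mul_le_one' prob_le_one prob_le_one).trans_lt ?_).ne
    simp
  have hev : ∀ a, ∀ᶠ m in atTop, ∀ k ∈ Finset.Iic n, ∀ q,
      ∫⁻ p in T ⁻¹' {q}, sectionCorr S (B k) a (j m) p ∂μ.prod μ ≤ I k q + η ∧
      ∫⁻ p in T ⁻¹' {q}, sectionCorr S (B k) (j m) a p ∂μ.prod μ ≤ I k q + η := by
    intro a
    rw [Filter.eventually_all_finset]
    intro k _
    rw [Filter.eventually_all]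
    intro q
    obtain ⟨h1, h2⟩ := h.tendsto_lintegral_sectionCorr (hB k) a (T ⁻¹' {q})
    have hlt : I k q < I k q + η := ENNReal.lt_add_right (hItop k q) hη0
    filter_upwards [h1.eventually_lt_const hlt, h2.eventually_lt_const hlt] with m h3 h4
    exact ⟨h3.le, h4.le⟩
  -- Each new power is taken so far along the mixing sequence that it decorrelates from all earlier
  -- ones, in both orders. Assigning distinct terms to distinct cells leaves only the diagonal
  -- cells, where the trivial bound `1` is used.
  obtain ⟨f, -, hf⟩ := exists_seq_of_forall_finset_exists (fun _ : ℕ => True)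
    (fun a b => ∀ k ∈ Finset.Iic n, ∀ q,
      ∫⁻ p in T ⁻¹' {q}, sectionCorr S (B k) a b p ∂μ.prod μ ≤ I k q + η ∧
      ∫⁻ p in T ⁻¹' {q}, sectionCorr S (B k) b a p ∂μ.prod μ ≤ I k q + η) (fun s _ => by
        obtain ⟨m, hm⟩ := ((Filter.eventually_all_finset s).2 fun a _ => hev a).exists
        exact ⟨j m, trivial, hm⟩)
  set e : ι → ℕ := fun i => Fintype.equivFin ι i with he
  have he_inj : Function.Injective e := Fin.val_injective.comp (Fintype.equivFin ι).injective
  refine ⟨fun i => f (e i), fun k hk => ?_⟩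
  have hdm : MeasurableSet {p : X × X | c p.1 = c p.2} :=
    measurableSet_eq_fun (hc.comp measurable_fst) (hc.comp measurable_snd)
  have hq : ∀ q, ∫⁻ p in T ⁻¹' {q}, sectionCorr S (B k) (f (e (c p.1))) (f (e (c p.2))) p
      ∂μ.prod μ ≤ ∫⁻ p in T ⁻¹' {q}, {p : X × X | c p.1 = c p.2}.indicator 1 p ∂μ.prod μ +
        I k q + η := by
    rintro ⟨i, l⟩
    have hcongr : ∫⁻ p in T ⁻¹' {(i, l)}, sectionCorr S (B k) (f (e (c p.1))) (f (e (c p.2))) p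
        ∂μ.prod μ = ∫⁻ p in T ⁻¹' {(i, l)}, sectionCorr S (B k) (f (e i)) (f (e l)) p
        ∂μ.prod μ := by
      refine setLIntegral_congr_fun (hTm (measurableSet_singleton _)) fun p hp => ?_
      obtain ⟨h1, h2⟩ := Prod.mk.inj hp
      simp only [h1, h2]
    rw [hcongr]
    rcases lt_trichotomy (e i) (e l) with hil | hil | hil
    · exact ((hf _ _ hil k (Finset.mem_Iic.2 hk) (i, l)).1).trans (by rw [add_assoc]; simp)
    · obtain rfl := he_inj hil
      rw [add_assoc]
      refine le_add_right (setLIntegral_mono' (hTm (measurableSet_singleton _)) fun p hp => ?_)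
      obtain ⟨h1, h2⟩ := Prod.mk.inj hp
      have hmem : p ∈ {p : X × X | c p.1 = c p.2} := h1.trans h2.symm
      rw [Set.indicator_of_mem hmem]
      exact sectionCorr_le_one _ _ _ _ _
    · exact ((hf _ _ hil k (Finset.mem_Iic.2 hk) (i, l)).2).trans (by rw [add_assoc]; simp)
  rw [lintegral_eq_sum_fiber _ hTm]
  refine (Finset.sum_le_sum fun q _ => hq q).trans ?_
  rw [Finset.sum_add_distrib, Finset.sum_add_distrib, ← lintegral_eq_sum_fiber _ hTm,
    ← lintegral_eq_sum_fiber _ hTm, lintegral_indicator_one hdm,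
    lintegral_section_mul_section (hB k)]
  gcongr
  rw [Finset.sum_const, Finset.card_univ, nsmul_eq_mul]
  exact ENNReal.mul_div_le

/-- `S × id` acts on each horizontal section of `Y` by `S`, so mixing on that section gives the
square of its measure; dominated convergence integrates this over `y`. -/
theorem IsMixingSeq.tendsto_measure_prod {S : Aut μ} {j : ℕ → ℕ} (h : IsMixingSeq S j)
    {Y : Set (X × X)} (hY : MeasurableSet Y) :
    Tendsto (fun k => (μ.prod μ) {p | p ∈ Y ∧ (S^[j k] p.1, p.2) ∈ Y}) atTop
      (𝓝 (∫⁻ y, μ {x | (x, y) ∈ Y} ^ 2 ∂μ)) := by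
  have hm : ∀ k, MeasurableSet {p : X × X | p ∈ Y ∧ (S^[j k] p.1, p.2) ∈ Y} := fun k =>
    hY.inter ((((S.measurable.iterate _).comp measurable_fst).prodMk measurable_snd) hY)
  simp_rw [Measure.prod_apply_symm (hm _)]
  refine tendsto_lintegral_of_dominated_convergence 1
    (fun k => measurable_measure_prodMk_right (hm k))
    (fun k => Eventually.of_forall fun y => prob_le_one) (by simp)
    (Eventually.of_forall fun y => ?_)
  have hYy := measurableSet_fst_section hY y
  rw [sq]
  refine (h _ _ hYy hYy).congr fun k => ?_
  rw [← S.measure_iterate_image (j k) ((fun x => (x, y)) ⁻¹' _)]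
  congr 1
  ext x
  constructor
  · rintro ⟨hx, z, hz, rfl⟩
    exact ⟨z, ⟨hz, hx⟩, rfl⟩
  · rintro ⟨z, ⟨hz, hx⟩, rfl⟩
    exact ⟨hx, z, hz, rfl⟩

/-- Fubini for the triples `(x, x', y)` with `(x, y), (x', y) ∈ Y`. This converts mixing of `S × id`
into near independence of vertical sections. -/
theorem lintegral_section_sq {Y : Set (X × X)} (hY : MeasurableSet Y) :
    ∫⁻ y, μ {x | (x, y) ∈ Y} ^ 2 ∂μ =
      ∫⁻ p, μ {y | (p.1, y) ∈ Y ∧ (p.2, y) ∈ Y} ∂μ.prod μ := by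
  have hm : MeasurableSet {q : (X × X) × X | (q.1.1, q.2) ∈ Y ∧ (q.1.2, q.2) ∈ Y} :=
    MeasurableSet.inter (((measurable_fst.comp measurable_fst).prodMk measurable_snd) hY)
      (((measurable_snd.comp measurable_fst).prodMk measurable_snd) hY)
  have h1 := Measure.prod_apply (μ := μ.prod μ) (ν := μ) hm
  rw [Measure.prod_apply_symm hm] at h1
  refine Eq.trans (lintegral_congr fun y => ?_) h1
  rw [sq, ← Measure.prod_prod]
  rfl

end

/-! ### Coboundaries and the perturbation of a given family. -/

section

variable {X : Type*} [MeasurableSpace X] {μ : Measure X}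

/-- The fibre automorphisms over `x` of the `k`-th inverse power of the skew product given by `F`. -/
def pullback (S : Aut μ) (F : X → Aut μ) : ℕ → X → Aut μ
  | 0, _ => Aut.refl μ
  | k + 1, x => (pullback S F k (S.symm x)).comp (F (S.symm x)).symm

/-- The time since the last visit of `x` to `E`. -/
noncomputable def backTime (S : Aut μ) (E : Set X) (x : X) : ℕ := sInf {n | S.symm^[n] x ∈ E}

/-- The point of `E` from which the orbit of `x` has last left `E`. -/
noncomputable def backPoint (S : Aut μ) (E : Set X) (x : X) : X := S.symm^[backTime S E x] x

theorem measurable_backTime (S : Aut μ) {E : Set X} (hE : MeasurableSet E) :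
    Measurable (backTime S E) :=
  measurable_sInf_mem fun n => (S.symm.measurable.iterate n) hE

theorem measurable_backPoint (S : Aut μ) {E : Set X} (hE : MeasurableSet E) :
    Measurable (backPoint S E) := by
  have h : Measurable (fun q : ℕ × X => S.symm^[q.1] q.2) :=
    measurable_from_prod_countable_right fun n => S.symm.measurable.iterate n
  exact h.comp ((measurable_backTime S hE).prodMk measurable_id)

/-- A past visit is required: without one both times are the default `0`. -/
theorem backTime_apply (S : Aut μ) {E : Set X} {x : X} (hx : ∃ n, S.symm^[n] x ∈ E)
    (hS : S x ∉ E) : backTime S E (S x) = backTime S E x + 1 := by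
  have hset : {n | S.symm^[n + 1] (S x) ∈ E} = {n | S.symm^[n] x ∈ E} := by
    ext n
    simp [Function.iterate_succ_apply]
  have hne : {n | S.symm^[n] (S x) ∈ E}.Nonempty := by
    obtain ⟨n, hn⟩ := hx
    exact ⟨n + 1, by simpa [Function.iterate_succ_apply] using hn⟩
  have hpos : 0 < sInf {n | S.symm^[n] (S x) ∈ E} := by
    rw [Nat.pos_iff_ne_zero]
    intro h0
    have := Nat.sInf_mem hne
    rw [h0] at this
    exact hS this
  unfold backTime
  rw [← hset]
  exact (Nat.sInf_add (p := fun n => S.symm^[n] (S x) ∈ E) hpos).symm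

theorem backPoint_apply (S : Aut μ) {E : Set X} {x : X}
    (h : backTime S E (S x) = backTime S E x + 1) : backPoint S E (S x) = backPoint S E x := by
  rw [backPoint, h, Function.iterate_succ_apply, S.symm_apply_apply, backPoint]

/-- Points with back point `z` lie on the forward orbit of `z`, which is countable. -/
theorem measure_preimage_backPoint [NullSingletonClass μ] (S : Aut μ) (E : Set X) (z : X) :
    μ (backPoint S E ⁻¹' {z}) = 0 := by
  refine measure_mono_null (t := Set.range fun n => S^[n] z) ?_ ((Set.countable_range _).measure_zero μ)
  rintro x rfl
  exact ⟨backTime S E x, S.iterate_iterate_symm _ _⟩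

variable [StandardBorelSpace X] [IsProbabilityMeasure μ]

/-- The pointwise composition of two families. -/
def Family.comp (F G : Family μ) : Family μ :=
  ⟨fun x => (F.1 x).comp (G.1 x), F.2.comp (measurable_fst.prodMk G.2)⟩

/-- The pointwise inverse of a family. -/
def Family.symm (F : Family μ) : Family μ := ⟨fun x => (F.1 x).symm, F.measurable_symm⟩

/-- The family indexed through a measurable map. -/
def Family.reindex (F : Family μ) {b : X → X} (hb : Measurable b) : Family μ :=
  ⟨fun x => F.1 (b x), F.2.comp ((hb.comp measurable_fst).prodMk measurable_snd)⟩

/-- A choice from countably many families. -/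
def Family.select (F : ℕ → Family μ) {k : X → ℕ} (hk : Measurable k) : Family μ :=
  ⟨fun x => (F (k x)).1 x, by
    have h : Measurable (fun q : ℕ × (X × X) => (F q.1).1 q.2.1 q.2.2) :=
      measurable_from_prod_countable_right fun n => (F n).2
    exact h.comp ((hk.comp measurable_fst).prodMk measurable_id)⟩

/-- The constant family. -/
def Family.const (T : Aut μ) : Family μ := ⟨fun _ => T, T.measurable.comp measurable_snd⟩

theorem measurable_pullback (S : Aut μ) (F : Family μ) (k : ℕ) :
    Measurable (fun p : X × X => pullback S F.1 k p.1 p.2) := by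
  induction k with
  | zero => exact measurable_snd
  | succ k ih =>
    let P : Family μ := ⟨pullback S F.1 k, ih⟩
    exact ((P.reindex S.symm.measurable).comp (F.symm.reindex S.symm.measurable)).2

theorem iterate_skew_refl (S : Aut μ) (n : ℕ) (p : X × X) :
    (skew S (Family.const (Aut.refl μ)))^[n] p = (S^[n] p.1, p.2) := by
  induction n generalizing p with
  | zero => rfl
  | succ n ih => rw [Function.iterate_succ_apply, ih, Function.iterate_succ_apply]; rfl

/-- The skew product over `S` that the fibre maps `G` conjugate to `S × id`. -/
def Family.coboundary (S : Aut μ) (G : Family μ) : Family μ :=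
  (G.symm.reindex S.measurable).comp G

theorem skew_semiconj_coboundary (S : Aut μ) (G : Family μ) :
    Function.Semiconj (skew (Aut.refl μ) G) (skew S (G.coboundary S))
      (skew S (Family.const (Aut.refl μ))) := by
  intro p
  exact Prod.ext rfl ((G.1 (S p.1)).apply_symm_apply (G.1 p.1 p.2))

/-- A coboundary has nearly mixing powers and piecewise powers close to the identity if the
conjugated sets have nearly independent sections. -/
theorem coboundary_mem_recurrentMixing {A : ℕ → Set (X × X)} (hA : ∀ k, MeasurableSet (A k))
    {S : Aut μ} {j : ℕ → ℕ} (hj : IsMixingSeq S j) (n : ℕ) (G : Family μ)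
    (hG : ∀ k ≤ n, ∫⁻ y, μ {x | (x, y) ∈ (skew (Aut.refl μ) G).symm ⁻¹' A k} ^ 2 ∂μ <
      (μ.prod μ (A k)) ^ 2 + ENNReal.ofReal (1 / (n + 1))) :
    skew S (G.coboundary S) ∈ recurrentMixing A S n := by
  set J := skew (Aut.refl μ) G with hJ
  set R := skew S (G.coboundary S) with hR
  set T := skew S (Family.const (Aut.refl μ)) with hT
  set A' : ℕ → Set (X × X) := fun k => J.symm ⁻¹' A k with hA'
  have hA'm : ∀ k, MeasurableSet (A' k) := fun k => J.symm.measurable (hA k)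
  have hAA' : ∀ k, A k = J ⁻¹' A' k := by
    intro k
    ext p
    simp [hA']
  have hsemi : ∀ (t : ℕ) (Y : Set (X × X)), R^[t] ⁻¹' (J ⁻¹' Y) = J ⁻¹' (T^[t] ⁻¹' Y) := by
    intro t Y
    rw [← Set.preimage_comp, ← Set.preimage_comp]
    rw [((skew_semiconj_coboundary S G).iterate_right t).comp_eq]
  have hev : ∀ᶠ m in atTop, ∀ k ∈ Finset.Iic n,
      (μ.prod μ) {p | p ∈ A' k ∧ (S^[j m] p.1, p.2) ∈ A' k} <
        (μ.prod μ (A k)) ^ 2 + ENNReal.ofReal (1 / (n + 1)) := by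
    rw [Filter.eventually_all_finset]
    exact fun k hk =>
      (hj.tendsto_measure_prod (hA'm k)).eventually_lt_const (hG k (Finset.mem_Iic.1 hk))
  obtain ⟨m, hm⟩ := hev.exists_forall_of_atTop
  -- Halved because `sum_symmDiff_le` doubles the approximation error.
  have hε : (0 : ℝ) < 1 / (n + 1) / 2 := by positivity
  choose C hCm hC c hc hcC using fun k => exists_countable_sections (μ := μ) (hA'm k) hε
  have hcc : Measurable (fun x => fun k : Fin (n + 1) => c k x) :=
    measurable_pi_lambda _ fun k => hc k
  -- Only the tail of `j` from `m` on is used, so every time that occurs is already nearly mixing.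
  -- The partition refines the labellings of all `C k`, `k ≤ n`.
  obtain ⟨r, D, hD, hcell, hhalf⟩ := (hj.comp_add m).exists_isPiecewisePower hcc
  refine ⟨r, fun i => j (i + m), D, hD, hhalf, fun k hk => ⟨fun i _ => ?_, ?_⟩⟩
  · have h1 := hm (i + m) (Nat.le_add_left _ _) k (Finset.mem_Iic.2 hk)
    have h2 : {p | p ∈ A' k ∧ (S^[j (i + m)] p.1, p.2) ∈ A' k} =
        A' k ∩ T^[j (i + m)] ⁻¹' A' k := by
      ext p
      simp [hT, iterate_skew_refl]
    rw [h2, ← J.measure_preimage, Set.preimage_inter, ← hsemi, ← hAA'] at h1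
    have h3 := (ENNReal.toReal_lt_toReal (measure_ne_top _ _) (by finiteness)).2 h1
    rw [ENNReal.toReal_add (by finiteness) (by finiteness), ENNReal.toReal_pow,
      ENNReal.toReal_ofReal (by positivity)] at h3
    exact h3
  · have hTfst : ∀ t, ∀ᵐ p ∂μ.prod μ, (T^[t] p).1 = S^[t] p.1 := fun t =>
      Eventually.of_forall fun p => by rw [hT, iterate_skew_refl]
    have h1 := hD.sum_symmDiff_le hTfst r (hA'm k) (hCm k)
    -- Points over `D i` keep their label and their second coordinate, so `C k` is fixed exactly.
    have h2 : ∀ i, D i ×ˢ Set.univ ∩ (C k ∆ (T^[j (i + m)] ⁻¹' C k)) = ∅ := by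
      intro i
      ext ⟨x, y⟩
      simp only [Set.mem_inter_iff, Set.mem_empty_iff_false, iff_false, not_and,
        Set.mem_symmDiff, Set.mem_preimage, hT, iterate_skew_refl]
      rintro ⟨hx, -⟩
      have h3 := congrFun (hcell i x hx) ⟨k, Nat.lt_succ_of_le hk⟩
      have h4 := hcC k _ _ y h3
      tauto
    simp only [h2, measureReal_empty, Finset.sum_const_zero, zero_add] at h1
    have h5 : ∀ i, (μ.prod μ).real (D i ×ˢ Set.univ ∩ (A k ∆ (R^[j (i + m)] ⁻¹' A k))) =
        (μ.prod μ).real (D i ×ˢ Set.univ ∩ (A' k ∆ (T^[j (i + m)] ⁻¹' A' k))) := by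
      intro i
      rw [← J.measureReal_preimage (D i ×ˢ Set.univ ∩ (A' k ∆ (T^[j (i + m)] ⁻¹' A' k))),
        Set.preimage_inter, Set.preimage_symmDiff, ← hsemi, ← hAA']
      rfl
    simp only [h5]
    have := hC k
    linarith

/-- Every measurable family is close to one whose skew product is nearly mixing along times at which
it is nearly the identity on a large part of the space. -/
theorem exists_edist_lt_mem_recurrentMixing [NullSingletonClass μ] {A : ℕ → Set (X × X)}
    (hA : ∀ k, MeasurableSet (A k)) {S : Aut μ} {j : ℕ → ℕ} (hj : IsMixingSeq S j) (n : ℕ)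
    (F : Family μ) {ε : ℝ≥0∞} (hε : 0 < ε) :
    ∃ F' : Family μ, edist F' F < ε ∧ skew S F' ∈ recurrentMixing A S n := by
  obtain ⟨E, hE, hE0, hEε⟩ := exists_measure_pos_lt (μ := μ) hε
  set δ : ℝ≥0∞ := ENNReal.ofReal (1 / (n + 1)) with hδ
  have hδ0 : 0 < δ := ENNReal.ofReal_pos.2 (by positivity)
  have hδ3 : 0 < δ / 3 := ENNReal.div_pos hδ0.ne' (by simp)
  -- `H x` transports the fibre over `x` back to the fibre over the last visited point of `E`, so `H
  -- (S x) ∘ F x = H x` unless `S x ∈ E`.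
  let H : Family μ := Family.select (fun k => ⟨_, measurable_pullback S F k⟩)
    (measurable_backTime S hE)
  obtain ⟨N, hN⟩ := ((tendsto_measure_bits_eq (measurable_backPoint S hE)
    (measure_preimage_backPoint S E)).eventually_lt_const hδ3).exists
  set c : X → (Fin N → Bool) := fun x => bits N (backPoint S E x) with hc
  have hcm : Measurable c := (measurable_bits N).comp (measurable_backPoint S hE)
  set B : ℕ → Set (X × X) := fun k => (skew (Aut.refl μ) H).symm ⁻¹' A k with hB
  have hBm : ∀ k, MeasurableSet (B k) := fun k => Aut.measurable _ (hA k)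
  obtain ⟨s, hs⟩ := hj.exists_lintegral_sectionCorr_le hcm hBm n hδ3
  have hsm : Measurable fun x => s (c x) := (measurable_of_countable s).comp hcm
  -- The label `c` also changes only on entering `E`, so the extra power of `S` cancels in the
  -- coboundary off `S ⁻¹' E`.
  let G : Family μ := (Family.select (fun k => Family.const (S.iter k)) hsm).comp H
  refine ⟨G.coboundary S, ?_, coboundary_mem_recurrentMixing hA hj n G fun k hk => ?_⟩
  · refine lt_of_le_of_lt ?_ hEε
    rw [Family.edist_def, ← S.measure_preimage E]
    refine measure_mono_ae ?_
    filter_upwards [hj.ae_exists_mem hE hE0] with x hx hne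
    by_contra hSx
    have ht := backTime_apply S hx hSx
    have hb : c (S x) = c x := by rw [hc]; simp only [backPoint_apply S ht]
    refine hne (Aut.ext fun y => ?_)
    have hH : H.1 (S x) (F.1 x y) = H.1 x y := by
      change pullback S F.1 (backTime S E (S x)) (S x) (F.1 x y) =
        pullback S F.1 (backTime S E x) x y
      rw [ht]
      simp [pullback]
    change (G.1 (S x)).symm (G.1 x y) = F.1 x y
    rw [show G.1 x y = G.1 (S x) (F.1 x y) from ?_, Aut.symm_apply_apply]
    change S.iter (s (c x)) (H.1 x y) = S.iter (s (c (S x))) (H.1 (S x) (F.1 x y))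
    rw [hb, hH]
  · have hY : MeasurableSet ((skew (Aut.refl μ) G).symm ⁻¹' A k) := Aut.measurable _ (hA k)
    rw [lintegral_section_sq hY]
    -- The integrand unfolds to `sectionCorr` of `B k`. One third of `δ` pays for pairs in the same
    -- cell, one for the correlation error, and the last makes the inequality strict.
    refine (hs k hk).trans_lt ?_
    rw [hB, Aut.measure_preimage, add_comm (_ : ℝ≥0∞) (_ ^ 2), add_assoc]
    refine ENNReal.add_lt_add_left (by finiteness) ?_
    calc _ ≤ δ / 3 + δ / 3 := add_le_add_left hN.le _
      _ < δ / 3 + δ / 3 + δ / 3 :=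
        ENNReal.lt_add_right (by finiteness) hδ3.ne'
      _ = δ := ENNReal.add_thirds δ

end

/-! ### The category argument. -/

section

variable {X : Type*} [MeasurableSpace X] {μ : Measure X}
variable [StandardBorelSpace X] [IsProbabilityMeasure μ]

theorem halmosDist_skew_le (A : ℕ → Set (X × X)) (S : Aut μ) (F G : Family μ) :
    halmosDist A (skew S F) (skew S G) ≤ 6 * (edist F G).toReal := by
  refine (halmosDist_le (N := {x | F.1 x ≠ G.1 x} ×ˢ Set.univ) fun p hp => ?_).trans_eq ?_
  · have h : F.1 p.1 = G.1 p.1 := by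
      by_contra hne
      exact hp ⟨hne, Set.mem_univ _⟩
    simp [h]
  · rw [measureReal_def, Measure.prod_prod, measure_univ, mul_one, Family.edist_def]

theorem exists_halmosDist_skew_eq_zero (A : ℕ → Set (X × X)) {S : Aut μ} {R : Aut (μ.prod μ)}
    (hR : R ∈ Ext S) : ∃ F : Family μ, halmosDist A R (skew S F) = 0 := by
  obtain ⟨F, hFm, hF⟩ := hR
  refine ⟨⟨F, hFm⟩, le_antisymm ?_ ?_⟩
  · refine (halmosDist_le (N := {p | R p ≠ (S p.1, F p.1 p.2)}) fun p hp => ?_).trans_eq ?_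
    · exact not_not.1 hp
    · have h0 : (μ.prod μ) {p | R p ≠ (S p.1, F p.1 p.2)} = 0 := hF
      simp [measureReal_def, h0]
  · exact tsum_nonneg fun i => mul_nonneg (by positivity) (halmosTerm_nonneg _ _ _)

/-- Baire is applied in the complete space `Family μ`, whose topology is strong enough to make `skew
S` continuous. Density passes to `Ext S` because every extension is at Halmos distance zero from
some `skew S F`. -/
theorem isGenericForExt_not_hasNontrivialIndepFactor [NullSingletonClass μ]
    {A : ℕ → Set (X × X)} (hA : (μ.prod μ).MeasureDense (Set.range A)) {S : Aut μ}
    (hS : WeaklyMixing S) : IsGenericForExt A S (fun R => ¬ HasNontrivialIndepFactor R) := by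
  let _ : PseudoMetricSpace (Aut (μ.prod μ)) := halmosMetric (μ.prod μ) A
  obtain ⟨j, -, hj⟩ := hS
  have hAm : ∀ k, MeasurableSet (A k) := fun k => hA.measurable _ ⟨k, rfl⟩
  have hopen : ∀ n, IsOpen (recurrentMixing A S n) := isOpen_recurrentMixing hA S
  have hcont : Continuous (skew S) := by
    refine continuous_iff_continuousAt.2 fun F => tendsto_iff_dist_tendsto_zero.2 ?_
    have h0 : Tendsto (fun G : Family μ => 6 * (edist G F).toReal) (𝓝 F) (𝓝 0) := by
      have h1 : Tendsto (fun G : Family μ => edist G F) (𝓝 F) (𝓝 0) := by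
        have : Continuous fun G : Family μ => edist G F := continuous_id.edist continuous_const
        simpa using this.tendsto F
      simpa using ((ENNReal.tendsto_toReal ENNReal.zero_ne_top).comp h1).const_mul 6
    exact squeeze_zero (fun _ => dist_nonneg) (fun G => halmosDist_skew_le A S G F) h0
  have hdense : Dense (⋂ n, skew S ⁻¹' recurrentMixing A S n) := by
    refine dense_iInter_of_isOpen_nat (fun n => (hopen n).preimage hcont) fun n F => ?_
    rw [EMetric.mem_closure_iff]
    intro ε hε
    obtain ⟨F', hF', hmem⟩ := exists_edist_lt_mem_recurrentMixing hAm (S := S) hj n F hε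
    exact ⟨F', hmem, by rwa [edist_comm]⟩
  refine ⟨⋂ n, Subtype.val ⁻¹' recurrentMixing A S n,
    IsGδ.iInter_of_isOpen fun n => (hopen n).preimage continuous_subtype_val, fun R => ?_,
    fun R hR => not_hasNontrivialIndepFactor hA R.2 fun n => Set.mem_iInter.1 hR n⟩
  rw [Metric.mem_closure_iff]
  intro ε hε
  obtain ⟨F, hF⟩ := exists_halmosDist_skew_eq_zero A R.2
  obtain ⟨F', hF', hmem⟩ := hdense.exists_mem_open
    (Metric.isOpen_ball.preimage hcont : IsOpen (skew S ⁻¹' Metric.ball (skew S F) ε))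
    ⟨F, Metric.mem_ball_self hε⟩
  refine ⟨⟨skew S F', skew_mem_Ext S F'⟩, Set.mem_iInter.2 fun n => Set.mem_iInter.1 hF' n, ?_⟩
  have h1 := dist_triangle R.1 (skew S F) (skew S F')
  have h2 : dist R.1 (skew S F) = 0 := hF
  have h3 : dist (skew S F) (skew S F') < ε := by
    rw [dist_comm]; exact hmem
  rw [Subtype.dist_eq]
  linarith

end

end GenericExt

theorem mainTheorem5 {X : Type*} [MeasurableSpace X] [StandardBorelSpace X]
    (μ : Measure X) [IsProbabilityMeasure μ] [NullSingletonClass μ]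
    (A : ℕ → Set (X × X)) (hA : (μ.prod μ).MeasureDense (Set.range A))
    (S : GenericExt.Aut μ) (hS : GenericExt.WeaklyMixing S) :
    GenericExt.IsGenericForExt A S (fun R => ¬ GenericExt.HasNontrivialIndepFactor R) :=
  GenericExt.isGenericForExt_not_hasNontrivialIndepFactor hA hS
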